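/- Arithmetic regularity lemma for $U^3$, II. Write $G=\mathbb{F}_5^n$ and $\mathbb{E}_{x\in X}g(x)=|X|^{-1}\sum_{x\in X}g(x)$ for a finite nonempty set $X$. For $g:G\to\mathbb{R}$ put $\|g\|_2=(\mathbb{E}_{x\in G}\,g(x)^2)^{1/2}$ and $$\|g\|_{U^3}=\Big(\mathbb{E}_{x,h_1,h_2,h_3\in G}\ \prod_{\epsilon\in\{0,1\}^3}g(x+\epsilon_1h_1+\epsilon_2h_2+\epsilon_3h_3)\Big)^{1/8}.$$ A (homogeneous) quadratic factor of complexity $(d_1,d_2)$ on $G$ is given by vectors $r_1,\dots,r_{d_1}\in\mathbb{F}_5^n$ and symmetric $n\times n$ matrices $M_1,\dots,M_{d_2}$ over $\mathbb{F}_5$, where $d_1,d_2\ge 0$. It is the pair $(\mathcal{B}_1,\mathcal{B}_2)$ of $\sigma$-algebras on $G$ in which $\mathcal{B}_1$ is generated by the functions $x\mapsto r_j^Tx$, and $\mathcal{B}_2$ by these together with the functions $x\mapsto x^TM_jx$; the atoms are the nonempty joint level sets of the generating functions. The factor $(\mathcal{B}_1,\mathcal{B}_2)$ refines $(\mathcal{B}_1',\mathcal{B}_2')$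 if, for $i=1,2$, every atom of $\mathcal{B}_i$ is contained in an atom of $\mathcal{B}_i'$. It has rank at least $t$ if $\operatorname{rk}(\lambda_1M_1+\dots+\lambda_{d_2}M_{d_2})\ge t$ whenever $\lambda_1,\dots,\lambda_{d_2}\in\mathbb{F}_5$ are not all zero. Finally, $\mathbb{E}(f|\mathcal{B}_2)(x)$ is the average of $f$ over the atom of $\mathcal{B}_2$ containing $x$. Proposition. Let $\delta>0$ and let $\omega_1,\omega_2:[0,\infty)\to(0,\infty)$ be arbitrary functions (in applications, rapidly growing ones). Then there are $n_0=n_0(\delta,\omega_1,\omega_2)$ and a function $C=C_{\delta,\omega_1,\omega_2}:\mathbb{N}\times\mathbb{N}\to\mathbb{N}$ with the following property. Let $n>n_0$, let $f:\mathbb{F}_5^n\to[-1,1]$ be a function, and let $(\mathcal{B}^{(0)}_1,\mathcal{B}^{(0)}_2)$ be a quadratic factor of complexity $(d_1^{(0)},d_2^{(0)})$ on $\mathbb{F}_5^n$. Then there is a quadratic factor $(\mathcal{B}_1,\mathcal{B}_2)$ on $\mathbb{F}_5^n$, of some complexity $(d_1,d_2)$, such that 1. $(\mathcal{B}_1,\mathcal{B}_2)$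 refines $(\mathcal{B}^{(0)}_1,\mathcal{B}^{(0)}_2)$; 2. $d_1,d_2\le C(d_1^{(0)},d_2^{(0)})$; 3. the rank of $(\mathcal{B}_1,\mathcal{B}_2)$ is at least $\omega_1(d_1+d_2)$; 4. there is a decomposition $f=f_1+f_2+f_3$ with $f_1=\mathbb{E}(f|\mathcal{B}_2)$, $\|f_2\|_2\le\delta$ and $\|f_3\|_{U^3}\le 1/\omega_2(d_1+d_2)$. -/

import Mathlib

open scoped BigOperators NNReal

noncomputable section

/-- The group `G = 𝔽₅ⁿ`. -/
abbrev F5n (n : ℕ) : Type := Fin n → ZMod 5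

/-- The norm `‖f‖₂ = (𝔼_x f(x)²)^{1/2}` with respect to the normalised counting measure. -/
def l2Norm {n : ℕ} (f : F5n n → ℝ) : ℝ :=
  Real.sqrt (𝔼 x, f x ^ 2)

/-- The average of `f` over 3-dimensional parallelepipeds, that is `‖f‖_{U³}⁸`. -/
def gowersU3Pow {n : ℕ} (f : F5n n → ℝ) : ℝ :=
  𝔼 x, 𝔼 h₁, 𝔼 h₂, 𝔼 h₃,
    f x * f (x + h₁) * f (x + h₂) * f (x + h₃) *
      f (x + h₁ + h₂) * f (x + h₁ + h₃) * f (x + h₂ + h₃) * f (x + h₁ + h₂ + h₃)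

/-- The average over parallelepipeds is nonnegative, so that its eighth root makes sense. -/
theorem gowersU3Pow_nonneg {n : ℕ} (f : F5n n → ℝ) : 0 ≤ gowersU3Pow f := by
  have key : gowersU3Pow f =
      𝔼 h₁, 𝔼 h₂, (𝔼 x, f x * f (x + h₁) * f (x + h₂) * f (x + h₁ + h₂)) ^ 2 := by
    unfold gowersU3Pow
    rw [Finset.expect_comm]
    refine Finset.expect_congr rfl fun h₁ _ => ?_
    rw [Finset.expect_comm]
    refine Finset.expect_congr rfl fun h₂ _ => ?_
    rw [sq, Finset.expect_mul]
    refine Finset.expect_congr rfl fun x _ => ?_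
    rw [Finset.mul_expect]
    refine Fintype.expect_equiv (Equiv.addLeft x) _ _ fun h₃ => ?_
    simp only [Equiv.coe_addLeft]
    rw [add_right_comm x h₃ h₁, add_right_comm x h₃ h₂, add_right_comm (x + h₁) h₃ h₂]
    ring
  rw [key]
  exact Finset.expect_nonneg fun _ _ => Finset.expect_nonneg fun _ _ => sq_nonneg _

/-- The Gowers norm `‖f‖_{U³}`. -/
def gowersU3Norm {n : ℕ} (f : F5n n → ℝ) : ℝ :=
  gowersU3Pow f ^ ((1 : ℝ) / 8)

/-- The conditional expectation `𝔼(f | B)`: its value at `x` is the average of `f` over the atom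
of `B` that contains `x`. A σ-algebra on the finite set `𝔽₅ⁿ` is given by its partition into
atoms, that is, by the equivalence relation of lying in the same atom. -/
def condAvg {n : ℕ} (B : Setoid (F5n n)) (f : F5n n → ℝ) (x : F5n n) : ℝ :=
  open Classical in 𝔼 y ∈ Finset.univ.filter (fun y => B x y), f y

/-- The data of a (homogeneous) quadratic factor of complexity `(d₁, d₂)`: vectors
`r₁, …, r_{d₁}` and symmetric matrices `M₁, …, M_{d₂}` over `𝔽₅`. -/
structure QuadraticFactor (n d₁ d₂ : ℕ) where
  /-- the vectors `r_j` -/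
  r : Fin d₁ → F5n n
  /-- the matrices `M_j` -/
  M : Fin d₂ → Matrix (Fin n) (Fin n) (ZMod 5)
  /-- the matrices `M_j` are symmetric -/
  symm : ∀ j, (M j).IsSymm

namespace QuadraticFactor

variable {n d₁ d₂ e₁ e₂ : ℕ}

/-- The map `Γ(x) = (r₁ᵀx, …, r_{d₁}ᵀx)`. -/
def linMap (Q : QuadraticFactor n d₁ d₂) (x : F5n n) : Fin d₁ → ZMod 5 :=
  fun j => Q.r j ⬝ᵥ x

/-- The map `Φ(x) = (xᵀM₁x, …, xᵀM_{d₂}x)`. -/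
def quadMap (Q : QuadraticFactor n d₁ d₂) (x : F5n n) : Fin d₂ → ZMod 5 :=
  fun j => x ⬝ᵥ (Q.M j).mulVec x

/-- The linear factor `B₁`, whose atoms are the level sets of `Γ`. -/
def B₁ (Q : QuadraticFactor n d₁ d₂) : Setoid (F5n n) :=
  Setoid.ker Q.linMap

/-- The factor `B₂`, whose atoms are the level sets of `(Γ, Φ)`. -/
def B₂ (Q : QuadraticFactor n d₁ d₂) : Setoid (F5n n) :=
  Setoid.ker fun x => (Q.linMap x, Q.quadMap x)

/-- `Q` refines `Q'`: every atom of `B₁`, respectively `B₂`, of `Q` is contained in an atom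
of the corresponding factor of `Q'`. -/
def Refines (Q : QuadraticFactor n d₁ d₂) (Q' : QuadraticFactor n e₁ e₂) : Prop :=
  Q.B₁ ≤ Q'.B₁ ∧ Q.B₂ ≤ Q'.B₂

/-- `Q` has rank at least `t`: each nontrivial linear combination of the `M_j` has rank at
least `t`. -/
def RankAtLeast (Q : QuadraticFactor n d₁ d₂) (t : ℝ) : Prop :=
  ∀ c : Fin d₂ → ZMod 5, c ≠ 0 → t ≤ ((∑ j, c j • Q.M j).rank : ℝ)

end QuadraticFactor

end

/-!
As long as `f - 𝔼(f | B₂)` has large `U³` norm, the inverse theorem for the `U³` norm supplies a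
quadratic phase correlating with it, and adding this phase to the factor increases the energy
`‖𝔼(f | B₂)‖₂² ≤ 1`. Boundedly many phases therefore make the remainder `f₃` as uniform as the
complexity of the initial factor demands. If the energy gained on the way is at most `δ²`, then by
Pythagoras the two projections of `f` differ by a function `f₂` with `‖f₂‖₂ ≤ δ`, and the initial
factor is the desired one. Otherwise the process is repeated with the finer factor, which can happen
only boundedly often. High rank is restored each time by trading a matrix that occurs in a low-rank
linear combination for the few linear forms that determine the combination; this never loses
information, and the number of matrices decreases.

In the inverse theorem, a function `f` with large `U³` norm has many derivatives
`x ↦ f(x) conj(f(x + h))` with a large Fourier coefficient, at a frequency `φ(h)` say. By the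
Cauchy–Schwarz inequality the graph of `φ` has many additive quadruples, so by the theorems of
Balog–Szemerédi–Gowers and Freiman `φ` agrees with an affine map `h ↦ T h + β` on a dense set. A
further use of Cauchy–Schwarz shows that `T` is symmetric up to a bilinear form of bounded rank. As
`p` is odd, the symmetric part of `T` is the derivative of a quadratic phase, and up to a linear
phase this is what `f` correlates with.
-/

noncomputable section

section DependentRandomChoice

open Finset

variable {V W : Type*}

/-- The common neighbourhood in `Y` of the vertices `a` and `z` of a bipartite graph `R`. -/
def commonNbrs (R : V → W → Prop) [DecidableRel R] (Y : Finset W) (a z : V) : Finset W :=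
  {c ∈ Y | R a c ∧ R z c}

theorem sum_card_filter_bipartiteBelow_product (R : V → W → Prop) [DecidableRel R]
    (bad : V → V → Prop) [DecidableRel bad] (X : Finset V) (Y : Finset W) :
    ∑ b ∈ Y, #{p ∈ X.bipartiteBelow R b ×ˢ X.bipartiteBelow R b | bad p.1 p.2} =
      ∑ p ∈ X ×ˢ X with bad p.1 p.2, #(commonNbrs R Y p.1 p.2) := by
  convert (sum_card_bipartiteAbove_eq_sum_card_bipartiteBelow (s := {p ∈ X ×ˢ X | bad p.1 p.2})
    (t := Y) fun p b => R p.1 b ∧ R p.2 b).symm using 3 with b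
  · ext p
    simp only [bipartiteBelow, mem_filter, mem_product]
    tauto
  · rfl

theorem sq_mul_le_sum_sq_card_bipartiteBelow (R : V → W → Prop) [DecidableRel R] (X : Finset V)
    {Y : Finset W} (hY : Y.Nonempty) {α : ℝ} (hα : 0 ≤ α)
    (hR : α * (#X * #Y) ≤ ∑ b ∈ Y, (#(X.bipartiteBelow R b) : ℝ)) :
    #Y * (α ^ 2 * (#X : ℝ) ^ 2) ≤ ∑ b ∈ Y, (#(X.bipartiteBelow R b) : ℝ) ^ 2 := by
  have hY0 : (0 : ℝ) < #Y := by exact_mod_cast hY.card_pos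
  refine le_of_mul_le_mul_left ?_ hY0
  calc #Y * (#Y * (α ^ 2 * (#X : ℝ) ^ 2)) = (α * (#X * #Y)) ^ 2 := by ring
    _ ≤ (∑ b ∈ Y, (#(X.bipartiteBelow R b) : ℝ)) ^ 2 := by gcongr
    _ ≤ #Y * ∑ b ∈ Y, (#(X.bipartiteBelow R b) : ℝ) ^ 2 := sq_sum_le_card_mul_sum_sq

/-- The neighbourhood of a random vertex `b` is large on average, while a pair with few common
neighbours is unlikely to lie in it. -/
theorem exists_large_bipartiteBelow_few_bad_pairs (R : V → W → Prop) [DecidableRel R]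
    (X : Finset V) {Y : Finset W} (hY : Y.Nonempty) {α : ℝ} (hα : 0 ≤ α)
    (hR : α * (#X * #Y) ≤ ∑ b ∈ Y, (#(X.bipartiteBelow R b) : ℝ)) :
    ∃ b ∈ Y, α / 2 * #X ≤ #(X.bipartiteBelow R b) ∧
      16 * #{p ∈ X.bipartiteBelow R b ×ˢ X.bipartiteBelow R b |
        #(commonNbrs R Y p.1 p.2) < α ^ 2 / 32 * #Y} ≤ #(X.bipartiteBelow R b) ^ 2 := by
  set N : W → Finset V := fun b => X.bipartiteBelow R b
  set bad : V → V → Prop := fun a z => #(commonNbrs R Y a z) < α ^ 2 / 32 * #Y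
  have few_bad : ∑ b ∈ Y, (#{p ∈ N b ×ˢ N b | bad p.1 p.2} : ℝ) ≤
      #Y * (α ^ 2 / 32 * (#X : ℝ) ^ 2) := by
    calc ∑ b ∈ Y, (#{p ∈ N b ×ˢ N b | bad p.1 p.2} : ℝ)
        = ∑ p ∈ X ×ˢ X with bad p.1 p.2, (#(commonNbrs R Y p.1 p.2) : ℝ) := by
          exact_mod_cast sum_card_filter_bipartiteBelow_product R bad X Y
      _ ≤ ∑ p ∈ X ×ˢ X with bad p.1 p.2, α ^ 2 / 32 * #Y :=
          sum_le_sum fun p hp => (mem_filter.1 hp).2.le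
      _ ≤ ∑ p ∈ X ×ˢ X, α ^ 2 / 32 * #Y :=
          sum_le_sum_of_subset_of_nonneg (filter_subset _ _) fun _ _ _ => by positivity
      _ = #Y * (α ^ 2 / 32 * (#X : ℝ) ^ 2) := by
          rw [sum_const, card_product, nsmul_eq_mul]; push_cast; ring
  obtain ⟨b, hb, hNb⟩ : ∃ b ∈ Y, α ^ 2 / 2 * (#X : ℝ) ^ 2 ≤
      (#(N b) : ℝ) ^ 2 - 16 * #{p ∈ N b ×ˢ N b | bad p.1 p.2} := by
    refine exists_le_of_sum_le hY ?_
    rw [sum_const, nsmul_eq_mul, sum_sub_distrib, ← mul_sum]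
    linarith [sq_mul_le_sum_sq_card_bipartiteBelow R X hY hα hR]
  refine ⟨b, hb, le_of_sq_le_sq ?_ (Nat.cast_nonneg _), ?_⟩
  · nlinarith [sq_nonneg (α * #X), (#{p ∈ N b ×ˢ N b | bad p.1 p.2}).cast_nonneg (α := ℝ)]
  · have : (16 * #{p ∈ N b ×ˢ N b | bad p.1 p.2} : ℝ) ≤ (#(N b) : ℝ) ^ 2 := by
      linarith [mul_nonneg (half_pos one_pos).le (sq_nonneg (α * #X)), hNb]
    exact_mod_cast this

theorem exists_subset_forall_few_bad_partners {N : Finset V} {bad : V → V → Prop}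
    [DecidableRel bad] (h : 16 * #{p ∈ N ×ˢ N | bad p.1 p.2} ≤ #N ^ 2) :
    ∃ B ⊆ N, 3 * #N ≤ 4 * #B ∧ ∀ a ∈ B, 4 * #{z ∈ N | bad a z} ≤ #N := by
  refine ⟨{a ∈ N | 4 * #{z ∈ N | bad a z} ≤ #N}, filter_subset _ _, ?_,
    fun a ha => (mem_filter.1 ha).2⟩
  have split := card_filter_add_card_filter_not (s := N) fun a => 4 * #{z ∈ N | bad a z} ≤ #N
  set E : Finset V := {a ∈ N | ¬ 4 * #{z ∈ N | bad a z} ≤ #N}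
  have markov : 4 * (#E * #N) ≤ #N * #N := by
    calc 4 * (#E * #N) = 4 * ∑ _a ∈ E, #N := by rw [sum_const, smul_eq_mul]
      _ ≤ 4 * ∑ a ∈ E, 4 * #{z ∈ N | bad a z} := by
          gcongr with a ha
          exact (not_le.1 (mem_filter.1 ha).2).le
      _ ≤ 4 * ∑ a ∈ N, 4 * #{z ∈ N | bad a z} := by
          gcongr
          exact filter_subset _ _
      _ = 16 * #{p ∈ N ×ˢ N | bad p.1 p.2} := by
          rw [← mul_sum, ← mul_assoc, card_filter, sum_product]
          simp only [card_filter]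
          norm_num
      _ ≤ #N * #N := by rwa [← sq]
  rcases N.card.eq_zero_or_pos with hN | hN
  · omega
  · have : 4 * #E ≤ #N := le_of_mul_le_mul_right (by rwa [mul_assoc]) hN
    omega

/-- The method of **dependent random choice**. -/
theorem exists_subset_forall_many_paths (R : V → W → Prop) [DecidableRel R]
    (X : Finset V) {Y : Finset W} (hY : Y.Nonempty) {α : ℝ} (hα : 0 ≤ α)
    (hR : α * (#X * #Y) ≤ ∑ b ∈ Y, (#(X.bipartiteBelow R b) : ℝ)) :
    ∃ B ⊆ X, α / 4 * #X ≤ #B ∧ ∀ a ∈ B, ∀ a' ∈ B,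
      α / 4 * #X ≤ #{z ∈ X | α ^ 2 / 32 * #Y ≤ #(commonNbrs R Y a z) ∧
        α ^ 2 / 32 * #Y ≤ #(commonNbrs R Y a' z)} := by
  classical
  obtain ⟨b, -, hlarge, hbad⟩ := exists_large_bipartiteBelow_few_bad_pairs R X hY hα hR
  obtain ⟨B, hBN, hB, hfew⟩ := exists_subset_forall_few_bad_partners
    (bad := fun a z => #(commonNbrs R Y a z) < α ^ 2 / 32 * #Y) hbad
  set N := X.bipartiteBelow R b
  set bad : V → Finset V := fun a => {z ∈ N | #(commonNbrs R Y a z) < α ^ 2 / 32 * #Y}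
  have hNX : N ⊆ X := filter_subset _ _
  have hB' : (3 * #N : ℝ) ≤ 4 * #B := by exact_mod_cast hB
  refine ⟨B, hBN.trans hNX, by linarith [(#N).cast_nonneg (α := ℝ)], fun a ha a' ha' => ?_⟩
  have good_subset : N \ (bad a ∪ bad a') ⊆ {z ∈ X | α ^ 2 / 32 * #Y ≤ #(commonNbrs R Y a z) ∧
      α ^ 2 / 32 * #Y ≤ #(commonNbrs R Y a' z)} := by
    intro z hz
    simp only [bad, mem_sdiff, mem_union, mem_filter, not_or, not_and, not_lt] at hz
    exact mem_filter.2 ⟨hNX hz.1, hz.2.1 hz.1, hz.2.2 hz.1⟩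
  have card_good : #N ≤ 2 * #(N \ (bad a ∪ bad a')) := by
    have := card_le_card_sdiff_add_card (s := N) (t := bad a ∪ bad a')
    have := card_union_le (bad a) (bad a')
    have : 4 * #(bad a) ≤ #N := hfew a ha
    have : 4 * #(bad a') ≤ #N := hfew a' ha'
    omega
  have : (#N : ℝ) ≤ 2 * #(N \ (bad a ∪ bad a')) := by exact_mod_cast card_good
  have : (#(N \ (bad a ∪ bad a')) : ℝ) ≤ _ := Nat.cast_le.2 (card_le_card good_subset)
  linarith

end DependentRandomChoice

section BalogSzemerediGowers

open Finset
open scoped Pointwise Combinatorics.Additive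

variable {G : Type*} [AddCommGroup G] [Fintype G]

/-- The autocorrelation of `F`, whose value at `d` for the indicator function of a set is the
number of representations of `d` as a difference of two elements of the set. -/
def autocorr (F : G → ℝ) (d : G) : ℝ :=
  ∑ u, F u * F (u - d)

theorem sum_mul_autocorr (g F : G → ℝ) :
    ∑ d, g d * autocorr F d = ∑ a, ∑ b, g (a - b) * (F a * F b) := by
  simp only [autocorr, mul_sum]
  rw [sum_comm]
  refine sum_congr rfl fun a _ => Fintype.sum_equiv (Equiv.subLeft a) _ _ fun d => ?_
  rw [Equiv.subLeft_apply, sub_sub_cancel]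

theorem sum_autocorr (F : G → ℝ) : ∑ d, autocorr F d = (∑ u, F u) ^ 2 := by
  simpa [sq, sum_mul_sum] using sum_mul_autocorr 1 F

theorem autocorr_nonneg {F : G → ℝ} (hF : 0 ≤ F) : 0 ≤ autocorr F :=
  fun _ => sum_nonneg fun _ _ => mul_nonneg (hF _) (hF _)

theorem card_mul_sq_le_autocorr {F : G → ℝ} (hF : 0 ≤ F) (S : Finset G) {a a' : G} {τ : ℝ}
    (hτ : 0 ≤ τ) (h : ∀ c ∈ S, τ ≤ F (a - c) ∧ τ ≤ F (a' - c)) :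
    #S * τ ^ 2 ≤ autocorr F (a - a') := by
  calc #S * τ ^ 2 = ∑ _c ∈ S, τ * τ := by rw [sum_const, nsmul_eq_mul, sq]
    _ ≤ ∑ c ∈ S, F (a - c) * F (a' - c) := by
        gcongr with c hc
        · exact hF _
        · exact (h c hc).1
        · exact (h c hc).2
    _ ≤ ∑ c, F (a - c) * F (a' - c) :=
        sum_le_sum_of_subset_of_nonneg (subset_univ _) fun _ _ _ => mul_nonneg (hF _) (hF _)
    _ = autocorr F (a - a') := by
        refine Fintype.sum_equiv (Equiv.subLeft a) _ _ fun c => ?_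
        rw [Equiv.subLeft_apply, sub_sub_sub_comm, sub_self, zero_sub, neg_sub]

omit [AddCommGroup G] in
theorem sum_indicator_one (Γ : Finset G) : ∑ u, (Γ : Set G).indicator (1 : G → ℝ) u = #Γ := by
  classical
  simp [Set.indicator_apply]

variable [DecidableEq G]

theorem autocorr_indicator (Γ : Finset G) (d : G) :
    autocorr ((Γ : Set G).indicator 1) d = #{u ∈ Γ | u - d ∈ Γ} := by
  simp only [autocorr, Set.indicator_apply, mem_coe, Pi.one_apply, mul_ite, mul_one, mul_zero,
    ← ite_and, sum_boole]
  congr 2 with u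
  simp [and_comm]

theorem addEnergy_eq_sum_autocorr_sq (Γ : Finset G) :
    (E[Γ] : ℝ) = ∑ d, autocorr ((Γ : Set G).indicator 1) d ^ 2 := by
  simp only [autocorr_indicator, sq, ← Nat.cast_mul, ← card_product]
  rw [addEnergy, card_eq_sum_card_fiberwise (f := fun q : (G × G) × G × G => q.1.1 - q.1.2)
    (t := univ) fun _ _ => mem_univ _]
  push_cast
  refine sum_congr rfl fun d _ => congrArg Nat.cast ?_
  refine card_nbij' (fun q => (q.1.1, q.2.2)) (fun p => ((p.1, p.1 - d), p.2 - d, p.2)) ?_ ?_ ?_ ?_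
  · rintro ⟨⟨a, a'⟩, b, b'⟩ h
    simp only [coe_filter, mem_filter, mem_product, Set.mem_ofPred_eq] at h
    obtain ⟨⟨⟨⟨ha, ha'⟩, hb, hb'⟩, h⟩, rfl⟩ := h
    have : b' - (a - a') = b := by
      rw [sub_sub_eq_add_sub, add_comm, ← h, add_sub_cancel_left]
    simp_all
  · rintro ⟨a, b⟩ h
    have : a + (b - d) = a - d + b := by rw [add_sub_left_comm, add_comm]
    simp_all
  · rintro ⟨⟨a, a'⟩, b, b'⟩ h
    simp only [coe_filter, mem_filter, mem_product, Set.mem_ofPred_eq] at h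
    obtain ⟨⟨-, h⟩, rfl⟩ := h
    have : b' - (a - a') = b := by
      rw [sub_sub_eq_add_sub, add_comm, ← h, add_sub_cancel_left]
    simp_all
  · rintro ⟨a, b⟩ -
    rfl

theorem sum_filter_autocorr_indicator (P : Finset G) (Γ : Finset G) :
    ∑ d ∈ P, autocorr ((Γ : Set G).indicator 1) d = ∑ b ∈ Γ, (#{a ∈ Γ | a - b ∈ P} : ℝ) := by
  have := sum_mul_autocorr ((P : Set G).indicator 1) ((Γ : Set G).indicator 1)
  simp only [Set.indicator_apply, mem_coe, Pi.one_apply, mul_ite, mul_one, mul_zero, ite_mul,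
    one_mul, zero_mul, sum_ite_mem, sum_ite_irrel, sum_const_zero, univ_inter] at this
  simpa only [natCast_card_filter] using this.trans sum_comm

/-- The pairs of `Γ` whose difference is popular form a dense graph, and two ends of a path of
length four in it differ by an element with many representations by differences. -/
theorem exists_subset_forall_le_autocorr_autocorr {F : G → ℝ} (hF : 0 ≤ F) {Γ : Finset G}
    (hΓ : Γ.Nonempty) {α τ : ℝ} (hα : 0 ≤ α) (hτ : 0 ≤ τ)
    (h : α * (#Γ * #Γ) ≤ ∑ b ∈ Γ, (#{a ∈ Γ | τ ≤ F (a - b)} : ℝ)) :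
    ∃ B ⊆ Γ, α / 4 * #Γ ≤ #B ∧ ∀ d ∈ B - B,
      α / 4 * #Γ * (α ^ 2 / 32 * #Γ * τ ^ 2) ^ 2 ≤ autocorr (autocorr F) d := by
  obtain ⟨B, hBΓ, hB, hpaths⟩ := exists_subset_forall_many_paths
    (fun a b => τ ≤ F (a - b)) Γ hΓ hα h
  refine ⟨B, hBΓ, hB, fun d hd => ?_⟩
  obtain ⟨a, ha, a', ha', rfl⟩ := mem_sub.1 hd
  have le_autocorr {a z : G}
      (h : α ^ 2 / 32 * #Γ ≤ #(commonNbrs (fun a b => τ ≤ F (a - b)) Γ a z)) :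
      α ^ 2 / 32 * #Γ * τ ^ 2 ≤ autocorr F (a - z) :=
    (mul_le_mul_of_nonneg_right h (sq_nonneg τ)).trans <|
      card_mul_sq_le_autocorr hF _ hτ fun c hc => (mem_filter.1 hc).2
  refine (mul_le_mul_of_nonneg_right (hpaths a ha a' ha') (sq_nonneg _)).trans <|
    card_mul_sq_le_autocorr (autocorr_nonneg hF) _ (by positivity) fun z hz => ?_
  exact ⟨le_autocorr (mem_filter.1 hz).2.1, le_autocorr (mem_filter.1 hz).2.2⟩

theorem sum_sq_le_mul_sum_filter_add {ι : Type*} (s : Finset ι) {r : ι → ℝ} {m τ : ℝ}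
    (hr : ∀ i ∈ s, 0 ≤ r i) (hrm : ∀ i ∈ s, r i ≤ m) (hτ : 0 ≤ τ) :
    ∑ i ∈ s, r i ^ 2 ≤ m * ∑ i ∈ s with τ ≤ r i, r i + τ * ∑ i ∈ s, r i := by
  rw [sum_filter, mul_sum, mul_sum, ← sum_add_distrib]
  refine sum_le_sum fun i hi => ?_
  split_ifs with h
  · nlinarith [mul_le_mul_of_nonneg_right (hrm i hi) (hr i hi), mul_nonneg hτ (hr i hi)]
  · nlinarith [mul_le_mul_of_nonneg_right (not_le.1 h).le (hr i hi)]

theorem card_sq_le_sum_card_filter_popular {α : ℝ} {Γ : Finset G} (hΓ : Γ.Nonempty)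
    (hα : 0 ≤ α) (hE : 2 * α * (#Γ : ℝ) ^ 3 ≤ E[Γ]) :
    α * (#Γ * #Γ) ≤ ∑ b ∈ Γ,
      (#{a ∈ Γ | α * #Γ ≤ autocorr ((Γ : Set G).indicator 1) (a - b)} : ℝ) := by
  set r := autocorr ((Γ : Set G).indicator 1) with hr
  have hm : (0 : ℝ) < #Γ := by exact_mod_cast hΓ.card_pos
  have one_nonneg : (0 : G → ℝ) ≤ (Γ : Set G).indicator 1 :=
    Set.indicator_nonneg fun _ _ => zero_le_one
  have r_le (d : G) : r d ≤ #Γ := by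
    rw [hr, autocorr_indicator]
    exact_mod_cast card_filter_le _ _
  have sum_popular := sum_filter_autocorr_indicator {d | α * #Γ ≤ r d} Γ
  simp only [mem_filter_univ] at sum_popular
  rw [← sum_popular]
  refine le_of_mul_le_mul_left ?_ hm
  have := sum_sq_le_mul_sum_filter_add univ (m := #Γ) (τ := α * #Γ)
    (fun d _ => autocorr_nonneg one_nonneg d)
    (fun d _ => r_le d) (by positivity)
  rw [sum_autocorr, sum_indicator_one, ← addEnergy_eq_sum_autocorr_sq] at this
  linarith

theorem balog_szemeredi_gowers {G : Type*} [AddCommGroup G] [Finite G] [DecidableEq G] {α : ℝ}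
    (hα : 0 < α) {Γ : Finset G} (hΓ : Γ.Nonempty) (hE : 2 * α * (#Γ : ℝ) ^ 3 ≤ E[Γ]) :
    ∃ B ⊆ Γ, α / 4 * #Γ ≤ #B ∧ (#(B - B) : ℝ) ≤ 2 ^ 14 / α ^ 10 * #B := by
  have := Fintype.ofFinite G
  have hm : (0 : ℝ) < #Γ := by exact_mod_cast hΓ.card_pos
  have one_nonneg : (0 : G → ℝ) ≤ (Γ : Set G).indicator 1 :=
    Set.indicator_nonneg fun _ _ => zero_le_one
  obtain ⟨B, hBΓ, hB, hrep⟩ := exists_subset_forall_le_autocorr_autocorr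
    (autocorr_nonneg one_nonneg) hΓ hα.le (by positivity)
    (card_sq_le_sum_card_filter_popular hΓ hα.le hE)
  set r := autocorr ((Γ : Set G).indicator 1)
  have card_sub : #(B - B) * (α ^ 9 / 2 ^ 12) ≤ #Γ := by
    refine le_of_mul_le_mul_right ?_ (pow_pos hm 7)
    calc #(B - B) * (α ^ 9 / 2 ^ 12) * (#Γ : ℝ) ^ 7
        = ∑ _d ∈ B - B, α / 4 * #Γ * (α ^ 2 / 32 * #Γ * (α * #Γ) ^ 2) ^ 2 := by
          rw [sum_const, nsmul_eq_mul]; ring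
      _ ≤ ∑ d ∈ B - B, autocorr (autocorr r) d := sum_le_sum hrep
      _ ≤ ∑ d, autocorr (autocorr r) d := sum_le_sum_of_subset_of_nonneg (subset_univ _)
          fun d _ _ => autocorr_nonneg (autocorr_nonneg (autocorr_nonneg one_nonneg)) d
      _ = #Γ * (#Γ : ℝ) ^ 7 := by
          rw [sum_autocorr, sum_autocorr, sum_autocorr, sum_indicator_one]; ring
  refine ⟨B, hBΓ, hB, ?_⟩
  rw [div_mul_eq_mul_div, le_div_iff₀ (by positivity)]
  calc #(B - B) * α ^ 10 = 2 ^ 12 * α * (#(B - B) * (α ^ 9 / 2 ^ 12)) := by ring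
    _ ≤ 2 ^ 12 * α * #Γ := by gcongr
    _ ≤ 2 ^ 14 * #B := by linarith

end BalogSzemerediGowers

section Freiman

open Finset
open scoped Pointwise Combinatorics.Additive

theorem card_sub_add_sub_add_le {G : Type*} [AddCommGroup G] [DecidableEq G] {B : Finset G}
    (hB : B.Nonempty) {K : ℝ} (hK : (#(B - B) : ℝ) ≤ K * #B) :
    (#((B - B) + (B - B) + B) : ℝ) ≤ K ^ 5 * #B := by
  have hB0 : (0 : ℝ) < #B := by exact_mod_cast hB.card_pos
  have pluennecke : (#(3 • B - 2 • B) : ℝ) ≤ (#(B - B) / #B) ^ (3 + 2) * #B := by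
    have := (NNRat.cast_le (K := ℝ)).2 (pluennecke_ruzsa_inequality_nsmul_sub_nsmul_sub hB B 3 2)
    push_cast at this
    exact this
  have : (B - B) + (B - B) + B = 3 • B - 2 • B := by
    rw [succ_nsmul B 2, two_nsmul]
    simp only [sub_eq_add_neg, neg_add]
    ac_rfl
  rw [this]
  refine pluennecke.trans ?_
  gcongr
  rwa [div_le_iff₀ hB0]

/-- Modulo the span of the covering set, `B - B` is closed under addition. -/
theorem exists_addSubgroup_coe_eq_sub_add {G : Type*} [AddCommGroup G] [DecidableEq G]
    {B F : Finset G} (hB : B.Nonempty) (hF : (B - B) + (B - B) ⊆ F + (B - B)) {S : AddSubgroup G}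
    (hFS : (F : Set G) ⊆ S) :
    ∃ A : AddSubgroup G, (A : Set G) = ((B - B : Finset G) : Set G) + S := by
  have add_mem {d d' : G} (hd : d ∈ B - B) (hd' : d' ∈ B - B) :
      ∃ d'' ∈ B - B, ∃ s ∈ S, d'' + s = d + d' := by
    obtain ⟨s, hs, d'', hd'', h⟩ := mem_add.1 (hF (add_mem_add hd hd'))
    exact ⟨d'', hd'', s, hFS hs, by rw [← h, add_comm]⟩
  refine ⟨{ carrier := ((B - B : Finset G) : Set G) + S
            zero_mem' := ?_, add_mem' := ?_, neg_mem' := ?_ }, rfl⟩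
  · rintro _ _ ⟨d, hd, s, hs, rfl⟩ ⟨d', hd', s', hs', rfl⟩
    obtain ⟨d'', hd'', t, ht, h⟩ := add_mem hd hd'
    exact ⟨d'', hd'', t + (s + s'), S.add_mem ht (S.add_mem hs hs'), by
      simp only
      rw [← add_assoc, h, add_add_add_comm]⟩
  · exact ⟨0, mem_coe.2 hB.zero_mem_sub, 0, S.zero_mem, zero_add 0⟩
  · rintro _ ⟨d, hd, s, hs, rfl⟩
    obtain ⟨x, hx, y, hy, rfl⟩ := mem_sub.1 (mem_coe.1 hd)
    exact ⟨y - x, mem_coe.2 (sub_mem_sub hy hx), -s, S.neg_mem hs, by simp only; abel⟩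

theorem card_span_finset_le {p : ℕ} [Fact p.Prime] {W : Type*} [AddCommGroup W]
    [Module (ZMod p) W] (F : Finset W) :
    Nat.card (Submodule.span (ZMod p) (F : Set W)) ≤ p ^ #F := by
  rw [Module.natCard_eq_pow_finrank (K := ZMod p), Nat.card_zmod]
  exact Nat.pow_le_pow_right (Fact.out : p.Prime).pos (finrank_span_finset_le_card F)

/-- **Freiman's theorem** in a vector space over `ZMod p`. -/
theorem exists_submodule_of_small_doubling {p : ℕ} [Fact p.Prime] {W : Type*} [AddCommGroup W]
    [Module (ZMod p) W] [DecidableEq W] {K : ℝ} {B : Finset W} (hB : B.Nonempty)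
    (hK : (#(B - B) : ℝ) ≤ K * #B) :
    ∃ H : Submodule (ZMod p) W, ((B - B : Finset W) : Set W) ⊆ H ∧
      (Nat.card H : ℝ) ≤ p ^ ⌊K ^ 5⌋₊ * K * #B := by
  obtain ⟨F, -, hFK, hF⟩ := ruzsa_covering_add hB (card_sub_add_sub_add_le hB hK)
  set S := Submodule.span (ZMod p) (F : Set W)
  obtain ⟨A, hA⟩ := exists_addSubgroup_coe_eq_sub_add hB hF
    (S := S.toAddSubgroup) Submodule.subset_span
  refine ⟨AddSubgroup.toZModSubmodule p A, fun d hd => ?_, ?_⟩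
  · exact hA ▸ ⟨d, hd, 0, S.zero_mem, add_zero d⟩
  have card_A : Nat.card A ≤ #(B - B) * Nat.card S := by
    calc Nat.card A = Nat.card (((B - B : Finset W) : Set W) + (S : Set W) : Set W) := by
          rw [← SetLike.coe_sort_coe, hA]; rfl
      _ ≤ Nat.card ((B - B : Finset W) : Set W) * Nat.card (S : Set W) := Set.natCard_add_le
      _ = #(B - B) * Nat.card S := by
          rw [SetLike.coe_sort_coe, SetLike.coe_sort_coe, Nat.card_eq_finsetCard]
  have card_S : (Nat.card S : ℝ) ≤ p ^ ⌊K ^ 5⌋₊ := by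
    exact_mod_cast (card_span_finset_le F).trans <|
      Nat.pow_le_pow_right (Fact.out : p.Prime).pos (Nat.le_floor hFK)
  calc (Nat.card A : ℝ) ≤ #(B - B) * Nat.card S := by exact_mod_cast card_A
    _ ≤ K * #B * p ^ ⌊K ^ 5⌋₊ := by gcongr; exact (Nat.cast_nonneg _).trans hK
    _ = p ^ ⌊K ^ 5⌋₊ * K * #B := by ring

/-- `T` is a linear section of the projection of `H` to `V`, extended to all of `V`. -/
theorem exists_linearMap_forall_mem {k V W : Type*} [Field k] [AddCommGroup V] [Module k V]
    [AddCommGroup W] [Module k W] (H : Submodule k (V × W)) :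
    ∃ T : V →ₗ[k] W, ∀ p ∈ H, (p.1, T p.1) ∈ H := by
  let π : H →ₗ[k] V := LinearMap.fst k V W ∘ₗ H.subtype
  obtain ⟨s, hs⟩ := π.rangeRestrict.exists_rightInverse_of_surjective π.range_rangeRestrict
  obtain ⟨T, hT⟩ := LinearMap.exists_extend (LinearMap.snd k V W ∘ₗ H.subtype ∘ₗ s)
  refine ⟨T, fun p hp => ?_⟩
  have p_mem : p.1 ∈ LinearMap.range π := ⟨⟨p, hp⟩, rfl⟩
  have fst_eq : (s ⟨p.1, p_mem⟩ : V × W).1 = p.1 :=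
    congrArg Subtype.val (LinearMap.congr_fun hs ⟨p.1, p_mem⟩)
  have snd_eq : T p.1 = (s ⟨p.1, p_mem⟩ : V × W).2 := LinearMap.congr_fun hT ⟨p.1, p_mem⟩
  have : (p.1, T p.1) = (s ⟨p.1, p_mem⟩ : V × W) := Prod.ext fst_eq.symm snd_eq
  exact this ▸ (s ⟨p.1, p_mem⟩).2

/-- A linear section splits `H` into its projection to `V` and its fibre over `0`. -/
theorem card_mul_natCard_comap_inr_le {k V W : Type*} [Field k] [AddCommGroup V] [Module k V]
    [AddCommGroup W] [Module k W] {H : Submodule k (V × W)} [Finite H] {φ : V → W} {A : Finset V}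
    (hH : ∀ x ∈ A, ∀ y ∈ A, (x, φ x) - (y, φ y) ∈ H) :
    #A * Nat.card (H.comap (LinearMap.inr k V W)) ≤ Nat.card H := by
  obtain ⟨T, hT⟩ := exists_linearMap_forall_mem H
  rcases A.eq_empty_or_nonempty with rfl | ⟨a, ha⟩
  · simp
  have mem (x : A) (z : H.comap (LinearMap.inr k V W)) : (x.1 - a, T (x.1 - a) + z) ∈ H := by
    simpa using H.add_mem (hT _ (hH x.1 x.2 a ha)) z.2
  have inj : Function.Injective fun q : A × H.comap (LinearMap.inr k V W) =>
      (⟨_, mem q.1 q.2⟩ : H) := by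
    rintro ⟨⟨x, hx⟩, z⟩ ⟨⟨y, hy⟩, w⟩ h
    simp only [Subtype.mk.injEq, Prod.mk.injEq, sub_left_inj] at h
    obtain ⟨rfl, h⟩ := h
    simpa using h
  simpa [Nat.card_prod] using Nat.card_le_card_of_injective _ inj

theorem exists_affine_of_graph_sub_mem {k V W : Type*} [Field k] [AddCommGroup V] [Module k V]
    [AddCommGroup W] [Module k W] [DecidableEq W] {H : Submodule k (V × W)} [Finite H]
    {φ : V → W} {A : Finset V} (hA : A.Nonempty) (hH : ∀ x ∈ A, ∀ y ∈ A, (x, φ x) - (y, φ y) ∈ H)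
    {L : ℝ} (hL : (Nat.card H : ℝ) ≤ L * #A) :
    ∃ (T : V →ₗ[k] W) (b : W), #A ≤ L * #{x ∈ A | φ x = T x + b} := by
  obtain ⟨T, hT⟩ := exists_linearMap_forall_mem H
  have hA0 : (0 : ℝ) < #A := by exact_mod_cast hA.card_pos
  obtain ⟨a, ha⟩ := hA
  set Z := H.comap (LinearMap.inr k V W)
  have : Finite Z := Finite.of_injective (fun z : Z => (⟨_, z.2⟩ : H)) fun z w h => by
    simpa using h
  have : Fintype Z := Fintype.ofFinite Z
  have defect_mem {x : V} (hx : x ∈ A) : φ x - φ a - T (x - a) ∈ Z := by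
    simpa [Z] using H.sub_mem (hH x hx a ha) (hT _ (hH x hx a ha))
  have card_Z : (Nat.card Z : ℝ) ≤ L := by
    refine le_of_mul_le_mul_left ?_ hA0
    rw [mul_comm _ L]
    exact le_trans (by exact_mod_cast card_mul_natCard_comap_inr_le hH) hL
  obtain ⟨v, -, hv⟩ := exists_le_card_fiber_of_nsmul_le_card_of_maps_to (s := A)
    (t := (univ : Finset Z).map (Function.Embedding.subtype _)) (b := (#A : ℝ) / Nat.card Z)
    (f := fun x => φ x - φ a - T (x - a)) (fun x hx => by simpa using defect_mem hx)
    (univ_nonempty.map) (by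
      rw [card_map, card_univ, ← Nat.card_eq_fintype_card, nsmul_eq_mul,
        mul_div_cancel₀ _ (by exact_mod_cast Nat.card_pos.ne')])
  refine ⟨T, φ a - T a + v, ?_⟩
  have fibre_eq : {x ∈ A | φ x - φ a - T (x - a) = v} = {x ∈ A | φ x = T x + (φ a - T a + v)} :=
    filter_congr fun x _ => by rw [map_sub, sub_sub, sub_eq_iff_eq_add]; abel_nf
  rw [div_le_iff₀ (by exact_mod_cast Nat.card_pos), fibre_eq, mul_comm] at hv
  exact hv.trans (by gcongr)

theorem exists_affine_of_addEnergy (p : ℕ) [Fact p.Prime] {κ : ℝ} (hκ : 0 < κ) :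
    ∃ c : ℝ, 0 < c ∧ ∀ (V W : Type*) [AddCommGroup V] [Module (ZMod p) V] [Finite V]
      [DecidableEq V] [AddCommGroup W] [Module (ZMod p) W] [Finite W] [DecidableEq W]
      (φ : V → W) (A : Finset V), A.Nonempty →
      κ * (#A : ℝ) ^ 3 ≤ E[A.image fun x => (x, φ x)] →
      ∃ (T : V →ₗ[ZMod p] W) (b : W), c * #A ≤ #{x ∈ A | φ x = T x + b} := by
  set α := κ / 2 with hα
  set K := 2 ^ 14 / α ^ 10
  set L := p ^ ⌊K ^ 5⌋₊ * K
  have hL : 0 < L := mul_pos (pow_pos (mod_cast (Fact.out : p.Prime).pos) _) (by positivity)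
  refine ⟨α / 4 / L, by positivity, fun V W _ _ _ _ _ _ _ _ φ A hA hE => ?_⟩
  set Γ := A.image fun x => (x, φ x)
  have mem_Γ {q : V × W} (hq : q ∈ Γ) : q.1 ∈ A ∧ (q.1, φ q.1) = q := by
    obtain ⟨x, hx, rfl⟩ := mem_image.1 hq
    exact ⟨hx, rfl⟩
  have card_Γ : #Γ = #A := card_image_of_injective _ fun x y h => congrArg Prod.fst h
  obtain ⟨B, hBΓ, hB, hdoubling⟩ := balog_szemeredi_gowers (α := α) (by positivity)
    (hA.image fun x => (x, φ x)) (by rw [card_Γ, hα, mul_div_cancel₀ _ two_ne_zero]; exact hE)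
  rw [card_Γ] at hB
  have hBn : B.Nonempty := by
    have : (0 : ℝ) < #A := by exact_mod_cast hA.card_pos
    exact card_pos.1 (by exact_mod_cast (by positivity : 0 < α / 4 * #A).trans_le hB)
  obtain ⟨H, hBH, hH⟩ := exists_submodule_of_small_doubling (p := p) hBn hdoubling
  have mem_B {x : V} (hx : x ∈ B.image Prod.fst) : (x, φ x) ∈ B := by
    obtain ⟨q, hq, rfl⟩ := mem_image.1 hx
    exact (mem_Γ (hBΓ hq)).2 ▸ hq
  have card_fst : #(B.image Prod.fst) = #B := card_image_of_injOn fun q hq q' hq' h => by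
    rw [← (mem_Γ (hBΓ hq)).2, ← (mem_Γ (hBΓ hq')).2, h]
  obtain ⟨T, b, hT⟩ := exists_affine_of_graph_sub_mem (φ := φ) (hBn.image Prod.fst)
    (fun x hx y hy => hBH (sub_mem_sub (mem_B hx) (mem_B hy))) (by rwa [card_fst])
  refine ⟨T, b, ?_⟩
  rw [div_mul_eq_mul_div, div_le_iff₀ hL, mul_comm _ L]
  calc α / 4 * #A ≤ #B := hB
    _ ≤ L * #{x ∈ B.image Prod.fst | φ x = T x + b} := by rwa [← card_fst]
    _ ≤ L * #{x ∈ A | φ x = T x + b} := by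
        gcongr
        exact fun x hx => (mem_Γ (hBΓ (mem_B hx))).1

end Freiman

section Fourier

open Finset
open scoped ComplexConjugate

variable {G : Type*} [AddCommGroup G] [Fintype G]

theorem conj_expect {ι : Type*} (s : Finset ι) (F : ι → ℂ) :
    conj (𝔼 i ∈ s, F i) = 𝔼 i ∈ s, conj (F i) :=
  map_expect (Complex.conjLIE.toLinearEquiv.restrictScalars ℚ≥0) F s

theorem norm_expect_le_one {ι : Type*} [Fintype ι] [Nonempty ι] {F : ι → ℂ}
    (hF : ∀ i, ‖F i‖ ≤ 1) : ‖𝔼 i, F i‖ ≤ 1 :=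
  (RCLike.norm_expect_le (K := ℂ)).trans (expect_le univ_nonempty fun i _ => hF i)

/-- The Fourier transform on a finite abelian group, with normalised averages on the physical side
and hence sums on the dual side. -/
def dft (F : G → ℂ) (ψ : AddChar G ℂ) : ℂ :=
  𝔼 x, F x * ψ (-x)

theorem sum_dft_mul_apply (F : G → ℂ) (x : G) : ∑ ψ, dft F ψ * ψ x = F x := by
  classical
  have orthogonality (y : G) : ∑ ψ : AddChar G ℂ, F y * ψ (-y) * ψ x =
      if y = x then F y * (Fintype.card G : ℂ) else 0 := by
    simp only [mul_assoc, ← AddChar.map_add_eq_mul, neg_add_eq_sub, ← mul_sum,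
      AddChar.sum_apply_eq_ite, sub_eq_zero, eq_comm (a := x), mul_ite, mul_zero]
  simp only [dft, expect_mul]
  rw [← expect_sum_comm]
  simp only [orthogonality, Fintype.expect_eq_sum_div_card, sum_ite_eq', mem_univ, if_true]
  exact mul_div_cancel_right₀ _ (by exact_mod_cast Fintype.card_ne_zero)

theorem conj_dft (F : G → ℂ) (ψ : AddChar G ℂ) : conj (dft F ψ) = 𝔼 x, conj (F x) * ψ x := by
  simp only [dft, conj_expect, map_mul, ← AddChar.map_neg_eq_conj, neg_neg]

theorem sum_norm_dft_sq (F : G → ℂ) : ∑ ψ, ‖dft F ψ‖ ^ 2 = 𝔼 x, ‖F x‖ ^ 2 := by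
  have complex_form : ∑ ψ, dft F ψ * conj (dft F ψ) = 𝔼 x, F x * conj (F x) := by
    simp only [conj_dft, mul_expect]
    rw [← expect_sum_comm]
    refine expect_congr rfl fun x _ => ?_
    rw [← sum_dft_mul_apply F x, sum_mul]
    refine sum_congr rfl fun ψ _ => ?_
    rw [sum_dft_mul_apply]
    ring
  have cast_form : ((∑ ψ, ‖dft F ψ‖ ^ 2 : ℝ) : ℂ) = ((𝔼 x, ‖F x‖ ^ 2 : ℝ) : ℂ) := by
    push_cast
    simpa only [← Complex.mul_conj'] using complex_form
  exact_mod_cast cast_form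

theorem norm_dft_le_one {F : G → ℂ} (hF : ∀ x, ‖F x‖ ≤ 1) (ψ : AddChar G ℂ) : ‖dft F ψ‖ ≤ 1 :=
  norm_expect_le_one fun x => by rw [norm_mul, AddChar.norm_apply, mul_one]; exact hF x

theorem sum_norm_dft_sq_le_one {F : G → ℂ} (hF : ∀ x, ‖F x‖ ≤ 1) : ∑ ψ, ‖dft F ψ‖ ^ 2 ≤ 1 := by
  rw [sum_norm_dft_sq]
  exact expect_le univ_nonempty fun x _ => pow_le_one₀ (norm_nonneg _) (hF x)

/-- The Gowers inner product on two-dimensional parallelograms. -/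
def boxAvg (a b c d : G → ℂ) : ℂ :=
  𝔼 x, 𝔼 h, 𝔼 k, a x * b (x + h) * c (x + k) * d (x + h + k)

theorem boxAvg_eq_sum_dft (a b c d : G → ℂ) :
    boxAvg a b c d = ∑ ψ, dft d ψ * dft a ψ * (dft b (-ψ) * dft c (-ψ)) := by
  have expand (ψ : AddChar G ℂ) : dft d ψ * dft a ψ * (dft b (-ψ) * dft c (-ψ)) =
      𝔼 x, 𝔼 y, 𝔼 z, dft d ψ * (a x * ψ (-x)) * (b y * (-ψ) (-y) * (c z * (-ψ) (-z))) := by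
    simp only [← mul_expect, ← expect_mul]
    rfl
  simp only [expand, boxAvg]
  rw [← expect_sum_comm]
  refine expect_congr rfl fun x _ => ?_
  rw [← expect_sum_comm]
  refine Fintype.expect_equiv (Equiv.addLeft x) _ _ fun h => ?_
  rw [← expect_sum_comm]
  refine Fintype.expect_equiv (Equiv.addLeft x) _ _ fun k => ?_
  simp only [Equiv.coe_addLeft]
  rw [← sum_dft_mul_apply d (x + h + k), mul_sum]
  refine sum_congr rfl fun ψ _ => ?_
  have phases : ψ (x + h + k) = ψ (-x) * ((-ψ) (-(x + h)) * (-ψ) (-(x + k))) := by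
    simp only [AddChar.neg_apply, neg_neg, ← AddChar.map_add_eq_mul]
    congr 1
    abel
  rw [phases]
  ring

theorem exists_norm_boxAvg_le_norm_dft (a : G → ℂ) {b c d : G → ℂ} (hb : ∀ x, ‖b x‖ ≤ 1)
    (hc : ∀ x, ‖c x‖ ≤ 1) (hd : ∀ x, ‖d x‖ ≤ 1) : ∃ ψ, ‖boxAvg a b c d‖ ≤ ‖dft a ψ‖ := by
  obtain ⟨ψ₀, -, hψ₀⟩ := univ.exists_max_image (fun ψ => ‖dft a ψ‖) univ_nonempty
  refine ⟨ψ₀, ?_⟩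
  have sum_neg : ∑ ψ, ‖dft b (-ψ)‖ ^ 2 = ∑ ψ, ‖dft b ψ‖ ^ 2 :=
    Fintype.sum_equiv (Equiv.neg _) _ _ fun _ => rfl
  have term_le (ψ : AddChar G ℂ) : ‖dft d ψ * dft a ψ * (dft b (-ψ) * dft c (-ψ))‖ ≤
      ‖dft a ψ₀‖ * ((‖dft d ψ‖ ^ 2 + ‖dft b (-ψ)‖ ^ 2) / 2) := by
    have am_gm : ‖dft d ψ‖ * ‖dft b (-ψ)‖ ≤ (‖dft d ψ‖ ^ 2 + ‖dft b (-ψ)‖ ^ 2) / 2 := by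
      linarith [two_mul_le_add_sq ‖dft d ψ‖ ‖dft b (-ψ)‖]
    simp only [norm_mul]
    calc ‖dft d ψ‖ * ‖dft a ψ‖ * (‖dft b (-ψ)‖ * ‖dft c (-ψ)‖)
        = ‖dft a ψ‖ * (‖dft d ψ‖ * ‖dft b (-ψ)‖) * ‖dft c (-ψ)‖ := by ring
      _ ≤ ‖dft a ψ₀‖ * ((‖dft d ψ‖ ^ 2 + ‖dft b (-ψ)‖ ^ 2) / 2) * 1 := by
        gcongr
        exacts [hψ₀ ψ (mem_univ _), norm_dft_le_one hc _]
      _ = _ := mul_one _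
  calc ‖boxAvg a b c d‖ ≤ ∑ ψ, ‖dft a ψ₀‖ * ((‖dft d ψ‖ ^ 2 + ‖dft b (-ψ)‖ ^ 2) / 2) := by
        rw [boxAvg_eq_sum_dft]
        exact norm_sum_le_of_le _ fun ψ _ => term_le ψ
    _ = ‖dft a ψ₀‖ * ((∑ ψ, ‖dft d ψ‖ ^ 2 + ∑ ψ, ‖dft b ψ‖ ^ 2) / 2) := by
        rw [← mul_sum, ← sum_div, sum_add_distrib, sum_neg]
    _ ≤ ‖dft a ψ₀‖ * ((1 + 1) / 2) := by
        gcongr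
        exacts [sum_norm_dft_sq_le_one hd, sum_norm_dft_sq_le_one hb]
    _ = ‖dft a ψ₀‖ := by ring

end Fourier

section CauchySchwarz

open Finset
open scoped ComplexConjugate

theorem sq_expect_le {ι : Type*} [Fintype ι] [Nonempty ι] (u : ι → ℝ) :
    (𝔼 i, u i) ^ 2 ≤ 𝔼 i, u i ^ 2 := by
  simpa using expect_mul_sq_le_sq_mul_sq univ u fun _ => (1 : ℝ)

theorem norm_expect_sq_le {ι : Type*} [Fintype ι] [Nonempty ι] (S : ι → ℂ) :
    ‖𝔼 i, S i‖ ^ 2 ≤ 𝔼 i, ‖S i‖ ^ 2 :=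
  (pow_le_pow_left₀ (norm_nonneg _) (RCLike.norm_expect_le (K := ℂ)) 2).trans (sq_expect_le _)

theorem norm_expect_mul_sq_le {ι : Type*} [Fintype ι] [Nonempty ι] {F : ι → ℂ}
    (hF : ∀ i, ‖F i‖ ≤ 1) (S : ι → ℂ) : ‖𝔼 i, F i * S i‖ ^ 2 ≤ 𝔼 i, ‖S i‖ ^ 2 := by
  refine (norm_expect_sq_le _).trans (expect_le_expect fun i _ => ?_)
  rw [norm_mul, mul_pow]
  exact mul_le_of_le_one_left (by positivity) (pow_le_one₀ (norm_nonneg _) (hF i))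

variable {G : Type*} [AddCommGroup G] [Fintype G]

theorem expect_norm_sq_expect_mul_translate (P u : G → ℂ) :
    ((𝔼 x, ‖𝔼 h, P h * u (x + h)‖ ^ 2 : ℝ) : ℂ) =
      𝔼 t, (𝔼 y, u y * conj (u (y - t))) * 𝔼 h, P h * conj (P (h - t)) := by
  have expand (x : G) : ((‖𝔼 h, P h * u (x + h)‖ ^ 2 : ℝ) : ℂ) =
      𝔼 h, 𝔼 t, P h * u (x + h) * (conj (P (h - t)) * conj (u (x + h - t))) := by
    push_cast
    rw [← Complex.mul_conj', conj_expect, expect_mul]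
    refine expect_congr rfl fun h _ => ?_
    rw [mul_expect]
    refine (Fintype.expect_equiv (Equiv.subLeft h) _ _ fun t => ?_).symm
    simp only [Equiv.subLeft_apply, map_mul, add_sub_assoc]
  rw [Complex.ofReal_expect]
  simp only [expand, mul_expect, expect_mul]
  rw [expect_comm]
  refine Eq.trans ?_ (expect_comm _ _ _)
  refine expect_congr rfl fun h _ => ?_
  rw [expect_comm]
  refine expect_congr rfl fun t _ => Fintype.expect_equiv (Equiv.addRight h) _ _ fun x => ?_
  simp only [Equiv.coe_addRight]
  ring

theorem norm_expect_mul_expect_translate_pow_four_le {u v : G → ℂ} (hu : ∀ x, ‖u x‖ ≤ 1)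
    (hv : ∀ x, ‖v x‖ ≤ 1) (P : G → ℂ) :
    ‖𝔼 x, u x * 𝔼 h, P h * v (x + h)‖ ^ 4 ≤ 𝔼 t, ‖𝔼 h, P h * conj (P (h - t))‖ ^ 2 := by
  have autocorr_v_le (t : G) : ‖𝔼 y, v y * conj (v (y - t))‖ ≤ 1 := norm_expect_le_one fun y => by
    rw [norm_mul, RCLike.norm_conj]
    exact mul_le_one₀ (hv _) (norm_nonneg _) (hv _)
  calc ‖𝔼 x, u x * 𝔼 h, P h * v (x + h)‖ ^ 4
      = (‖𝔼 x, u x * 𝔼 h, P h * v (x + h)‖ ^ 2) ^ 2 := by ring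
    _ ≤ (𝔼 x, ‖𝔼 h, P h * v (x + h)‖ ^ 2) ^ 2 := by
        gcongr
        exact norm_expect_mul_sq_le hu _
    _ = ‖((𝔼 x, ‖𝔼 h, P h * v (x + h)‖ ^ 2 : ℝ) : ℂ)‖ ^ 2 := by
        rw [Complex.norm_real, Real.norm_eq_abs, sq_abs]
    _ ≤ _ := by
        rw [expect_norm_sq_expect_mul_translate]
        exact norm_expect_mul_sq_le autocorr_v_le _

theorem card_filter_eq_le_card_ker {H : Type*} [AddCommGroup H] [DecidableEq H] (S : G →+ H)
    (z : H) : #{y | S y = z} ≤ Nat.card S.ker := by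
  classical
  rcases em (∃ w, S w = z) with ⟨w, rfl⟩ | hz
  · rw [AddMonoidHom.card_fiber_eq_of_mem_range S ⟨w, rfl⟩ ⟨0, map_zero S⟩, ← Fintype.card_subtype,
      ← Nat.card_eq_fintype_card]
    rfl
  · rw [filter_false_of_mem fun y _ hy => hz ⟨y, hy⟩, card_empty]
    exact zero_le

variable {H : Type*} [AddCommGroup H] [Fintype H]

theorem dft_expect_mul_apply {ι : Type*} [Fintype ι] (v : ι → ℂ)
    (S : ι → AddChar H ℂ) (ψ : AddChar H ℂ) :
    dft (fun x => 𝔼 y, v y * S y x) ψ = 𝔼 y, if S y = ψ then v y else 0 := by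
  simp only [dft, expect_mul]
  rw [expect_comm]
  refine expect_congr rfl fun y _ => ?_
  have quotient (x : H) : v y * S y x * ψ (-x) = v y * (S y - ψ) x := by
    rw [mul_assoc, AddChar.sub_apply']
    simp [AddChar.map_neg_eq_inv, div_eq_mul_inv]
  simp only [quotient, ← mul_expect, AddChar.expect_eq_ite, sub_eq_zero, mul_ite, mul_one, mul_zero]

/-- The function `x ↦ 𝔼_y v(y) S(y)(x)` has Fourier transform at most the density of `ker S`. -/
theorem norm_expect_mul_mul_apply_sq_mul_card_range_le {u : H → ℂ} {v : G → ℂ}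
    (hu : ∀ x, ‖u x‖ ≤ 1) (hv : ∀ y, ‖v y‖ ≤ 1) (S : G →+ AddChar H ℂ) :
    ‖𝔼 x, 𝔼 y, u x * v y * S y x‖ ^ 2 * Nat.card S.range ≤ 1 := by
  classical
  set R : H → ℂ := fun x => 𝔼 y, v y * S y x with hR
  set p : AddChar H ℂ → ℝ := fun ψ => 𝔼 y, if S y = ψ then (1 : ℝ) else 0 with hp
  have hcard : (0 : ℝ) < Fintype.card G := by exact_mod_cast Fintype.card_pos
  have norm_dft_le (ψ : AddChar H ℂ) : ‖dft R ψ‖ ≤ p ψ := by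
    rw [hR, dft_expect_mul_apply]
    refine (RCLike.norm_expect_le (K := ℂ)).trans (expect_le_expect fun y _ => ?_)
    split_ifs
    exacts [hv y, norm_zero.le]
  have (ψ : AddChar H ℂ) : 0 ≤ p ψ := (norm_nonneg _).trans (norm_dft_le ψ)
  have sum_p : ∑ ψ, p ψ = 1 := by
    simp only [hp]
    rw [← expect_sum_comm]
    simp
  have p_le (ψ : AddChar H ℂ) : p ψ ≤ Nat.card S.ker / Fintype.card G := by
    simp only [hp, Fintype.expect_eq_sum_div_card, sum_boole]
    gcongr
    exact card_filter_eq_le_card_ker S ψ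
  have ker_mul_range : (Nat.card S.ker : ℝ) * Nat.card S.range = Fintype.card G := by
    rw [← AddSubgroup.index_ker, ← Nat.card_eq_fintype_card]
    exact_mod_cast S.ker.card_mul_index
  calc ‖𝔼 x, 𝔼 y, u x * v y * S y x‖ ^ 2 * Nat.card S.range
      = ‖𝔼 x, u x * R x‖ ^ 2 * Nat.card S.range := by simp only [hR, mul_expect, mul_assoc]
    _ ≤ (∑ ψ, ‖dft R ψ‖ ^ 2) * Nat.card S.range := by
        rw [sum_norm_dft_sq]
        gcongr
        exact norm_expect_mul_sq_le hu R
    _ ≤ (∑ ψ, Nat.card S.ker / Fintype.card G * p ψ) * Nat.card S.range := by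
        gcongr with ψ
        rw [sq]
        exact mul_le_mul ((norm_dft_le ψ).trans (p_le ψ)) (norm_dft_le ψ) (norm_nonneg _)
          (by positivity)
    _ = 1 := by
        rw [← mul_sum, sum_p, mul_one, div_mul_eq_mul_div, ker_mul_range, div_self hcard.ne']

end CauchySchwarz

section MulDeriv

open Finset
open scoped ComplexConjugate Combinatorics.Additive

variable {G : Type*} [AddCommGroup G]

/-- The multiplicative derivative of `f` in direction `h`. -/
def mulDeriv (f : G → ℂ) (h x : G) : ℂ :=
  f x * conj (f (x + h))

theorem norm_mulDeriv_le_one {f : G → ℂ} (hf : ∀ x, ‖f x‖ ≤ 1) (h x : G) :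
    ‖mulDeriv f h x‖ ≤ 1 := by
  rw [mulDeriv, norm_mul, RCLike.norm_conj]
  exact mul_le_one₀ (hf _) (norm_nonneg _) (hf _)

variable [Fintype G]

/-- The average of a complex-valued function over three-dimensional parallelepipeds, that is
`‖f‖_{U³}⁸`, written as an average of two-dimensional averages of derivatives. -/
def gowersU3Avg (f : G → ℂ) : ℂ :=
  𝔼 h, boxAvg (mulDeriv f h) (fun x => conj (mulDeriv f h x)) (fun x => conj (mulDeriv f h x))
    (mulDeriv f h)

theorem exists_norm_gowersU3Avg_le {f : G → ℂ} (hf : ∀ x, ‖f x‖ ≤ 1) :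
    ∃ φ : G → AddChar G ℂ, ‖gowersU3Avg f‖ ≤ 𝔼 h, ‖dft (mulDeriv f h) (φ h)‖ := by
  have conj_le (h x : G) : ‖conj (mulDeriv f h x)‖ ≤ 1 :=
    (RCLike.norm_conj _).trans_le (norm_mulDeriv_le_one hf h x)
  choose φ hφ using fun h => exists_norm_boxAvg_le_norm_dft (mulDeriv f h) (conj_le h) (conj_le h)
    (norm_mulDeriv_le_one hf h)
  exact ⟨φ, (RCLike.norm_expect_le (K := ℂ)).trans (expect_le_expect fun h _ => hφ h)⟩

theorem norm_dft_mulDeriv_sq (f : G → ℂ) (h : G) (ψ : AddChar G ℂ) :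
    ((‖dft (mulDeriv f h) ψ‖ ^ 2 : ℝ) : ℂ) =
      𝔼 x, 𝔼 k, f x * conj (f (x + h)) * (conj (f (x + k)) * f (x + k + h)) * ψ k := by
  push_cast
  rw [← Complex.mul_conj', conj_dft, dft, expect_mul]
  refine expect_congr rfl fun x _ => ?_
  rw [mul_expect]
  refine (Fintype.expect_equiv (Equiv.addLeft x) _ _ fun k => ?_).symm
  have phases : ψ k = ψ (-x) * ψ (x + k) := by rw [← AddChar.map_add_eq_mul, neg_add_cancel_left]
  simp only [Equiv.coe_addLeft, mulDeriv, map_mul, Complex.conj_conj, phases]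
  ring

variable [DecidableEq G]

theorem expect_norm_dft_mulDeriv_sq (f : G → ℂ) (φ : G → AddChar G ℂ) (A : Finset G) :
    ((𝔼 h, if h ∈ A then ‖dft (mulDeriv f h) (φ h)‖ ^ 2 else 0 : ℝ) : ℂ) =
      𝔼 k, 𝔼 x, mulDeriv f k x *
        𝔼 h, (if h ∈ A then φ h k else 0) * conj (mulDeriv f k (x + h)) := by
  have expand (h : G) : ((if h ∈ A then ‖dft (mulDeriv f h) (φ h)‖ ^ 2 else 0 : ℝ) : ℂ) =
      𝔼 k, 𝔼 x, mulDeriv f k x *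
        ((if h ∈ A then φ h k else 0) * conj (mulDeriv f k (x + h))) := by
    split_ifs
    · rw [norm_dft_mulDeriv_sq, expect_comm]
      refine expect_congr rfl fun k _ => expect_congr rfl fun x _ => ?_
      rw [mulDeriv, mulDeriv, map_mul, Complex.conj_conj, add_right_comm x k h]
      ring
    · simp
  simp only [Complex.ofReal_expect, expand, mul_expect]
  rw [expect_comm]
  exact expect_congr rfl fun k _ => expect_comm _ _ _

theorem card_mul_norm_dft_expect_graph (φ : G → AddChar G ℂ) (A : Finset G) (t : G)
    (ψ : AddChar G ℂ) :
    Fintype.card G * ‖dft (fun k => 𝔼 h, (if h ∈ A then φ h k else 0) *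
        conj (if h - t ∈ A then φ (h - t) k else 0)) ψ‖ =
      autocorr (((A.image fun x => (x, φ x) : Finset (G × AddChar G ℂ)) :
        Set (G × AddChar G ℂ)).indicator 1) (t, ψ) := by
  have difference_char (h k : G) : (if h ∈ A then φ h k else 0) *
      conj (if h - t ∈ A then φ (h - t) k else 0) =
        (if h ∈ A ∧ h - t ∈ A then 1 else 0) * (φ h - φ (h - t)) k := by
    by_cases hA : h ∈ A <;> by_cases hA' : h - t ∈ A <;>
      simp [hA, hA', AddChar.sub_apply, AddChar.map_neg_eq_conj]
  simp only [difference_char]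
  rw [dft_expect_mul_apply, autocorr_indicator]
  simp only [← ite_and, Fintype.expect_eq_sum_div_card, sum_boole, norm_div, Complex.norm_natCast]
  rw [mul_div_cancel₀ _ (by exact_mod_cast Fintype.card_ne_zero)]
  refine congrArg Nat.cast (card_nbij (fun h => (h, φ h)) ?_ ?_ ?_)
  · intro h hh
    obtain ⟨hψ, hA, hA'⟩ := (mem_filter.1 hh).2
    exact mem_filter.2 ⟨mem_image_of_mem _ hA, mem_image.2 ⟨h - t, hA', by rw [← hψ]; simp⟩⟩
  · exact fun h _ h' _ e => congrArg Prod.fst e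
  · rintro _ hq
    obtain ⟨hq, hq'⟩ := mem_filter.1 hq
    obtain ⟨h, hA, rfl⟩ := mem_image.1 hq
    obtain ⟨h', hA', e⟩ := mem_image.1 hq'
    obtain ⟨rfl, hψ⟩ := Prod.ext_iff.1 e
    refine ⟨h, mem_coe.2 (mem_filter.2 ⟨mem_univ _, ?_, hA, hA'⟩), rfl⟩
    change φ (h - t) = φ h - ψ at hψ
    rw [hψ, sub_sub_cancel]

theorem expect_norm_dft_mulDeriv_pow_four_le_addEnergy {f : G → ℂ} (hf : ∀ x, ‖f x‖ ≤ 1)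
    (φ : G → AddChar G ℂ) (A : Finset G) :
    (𝔼 h, if h ∈ A then ‖dft (mulDeriv f h) (φ h)‖ ^ 2 else 0) ^ 4 * (Fintype.card G : ℝ) ^ 3 ≤
      E[A.image fun x => (x, φ x)] := by
  set E : ℝ := 𝔼 h, if h ∈ A then ‖dft (mulDeriv f h) (φ h)‖ ^ 2 else 0
  set N : ℝ := (Fintype.card G : ℝ) with hN
  set P : G → G → ℂ := fun k h => if h ∈ A then φ h k else 0
  set X : G → ℂ := fun k => 𝔼 x, mulDeriv f k x * 𝔼 h, P k h * conj (mulDeriv f k (x + h))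
  have E_eq : (E : ℂ) = 𝔼 k, X k := expect_norm_dft_mulDeriv_sq f φ A
  have E_pow_le : E ^ 4 ≤ 𝔼 t, ∑ ψ, ‖dft (fun k => 𝔼 h, P k h * conj (P k (h - t))) ψ‖ ^ 2 :=
    calc E ^ 4 = (‖𝔼 k, X k‖ ^ 2) ^ 2 := by
          rw [← E_eq, Complex.norm_real, Real.norm_eq_abs, sq_abs]
          ring
      _ ≤ (𝔼 k, ‖X k‖ ^ 2) ^ 2 := by
          gcongr
          exact norm_expect_sq_le _
      _ ≤ 𝔼 k, (‖X k‖ ^ 2) ^ 2 := sq_expect_le _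
      _ ≤ 𝔼 k, 𝔼 t, ‖𝔼 h, P k h * conj (P k (h - t))‖ ^ 2 := by
          refine expect_le_expect fun k _ => ?_
          rw [← pow_mul]
          exact norm_expect_mul_expect_translate_pow_four_le (norm_mulDeriv_le_one hf k)
            (fun x => (RCLike.norm_conj _).trans_le (norm_mulDeriv_le_one hf k x)) (P k)
      _ = _ := by
          rw [expect_comm]
          simp only [sum_norm_dft_sq]
  calc E ^ 4 * N ^ 3
      ≤ (𝔼 t, ∑ ψ, ‖dft (fun k => 𝔼 h, P k h * conj (P k (h - t))) ψ‖ ^ 2) * N ^ 3 := by gcongr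
    _ = ∑ t, ∑ ψ, (N * ‖dft (fun k => 𝔼 h, P k h * conj (P k (h - t))) ψ‖) ^ 2 := by
        rw [pow_succ' N 2, ← mul_assoc, mul_comm _ N, hN, Fintype.card_mul_expect]
        simp only [mul_pow, ← mul_sum, mul_comm]
    _ = E[A.image fun x => (x, φ x)] := by
        rw [addEnergy_eq_sum_autocorr_sq, Fintype.sum_prod_type]
        simp only [P, hN, card_mul_norm_dft_expect_graph]

end MulDeriv

section Bicharacters

open Finset
open scoped ComplexConjugate

variable {G : Type*} [AddCommGroup G]

/-- The transpose `(y, x) ↦ T x y` of a bicharacter `(x, y) ↦ T x y`. -/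
def bicharFlip {H : Type*} [AddCommGroup H] (T : G →+ AddChar H ℂ) : H →+ AddChar G ℂ where
  toFun y := (AddChar.doubleDualEmb y).compAddMonoidHom T
  map_zero' := by ext; simp
  map_add' := by intros; ext; simp

theorem bicharFlip_apply_apply {H : Type*} [AddCommGroup H] (T : G →+ AddChar H ℂ) (x : G)
    (y : H) : bicharFlip T y x = T x y :=
  rfl

variable [Fintype G]

theorem expect_norm_dft_mulDeriv_affine_sq (f : G → ℂ) (T : G →+ AddChar G ℂ)
    (β : AddChar G ℂ) :
    ((𝔼 h, ‖dft (mulDeriv f h) (T h + β)‖ ^ 2 : ℝ) : ℂ) =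
      𝔼 u, 𝔼 x, 𝔼 y, (f x * f (u - x) * (T x (x - u) * β (-x))) *
        (conj (f y) * conj (f (u - y)) * (T y (u - y) * β (u - y))) *
          (bicharFlip T - T) y x := by
  simp only [Complex.ofReal_expect, norm_dft_mulDeriv_sq]
  rw [expect_comm]
  refine Eq.trans (expect_congr rfl fun x _ => ?_) (expect_comm _ _ _)
  refine Eq.trans ?_ (expect_comm _ _ _)
  refine Fintype.expect_equiv (Equiv.addLeft x) _ _ fun h =>
    Fintype.expect_equiv (Equiv.addLeft (x + (x + h))) _ _ fun k => ?_
  have phases : (T h + β) k = T x (x - (x + (x + h) + k)) * β (-x) *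
      (T (x + h) (x + k) * β (x + k)) * (bicharFlip T - T) (x + h) x := by
    simp only [AddMonoidHom.sub_apply, AddChar.sub_apply', bicharFlip_apply_apply, map_add,
      AddChar.add_apply, AddChar.map_sub_eq_div, AddChar.map_add_eq_mul, AddChar.map_neg_eq_inv]
    have ne (ψ : AddChar G ℂ) (z : G) : ψ z ≠ 0 := (ψ.val_isUnit z).ne_zero
    field_simp [ne]
  simp only [Equiv.coe_addLeft]
  rw [show x + (x + h) + k - x = x + k + h by abel,
    show x + (x + h) + k - (x + h) = x + k by abel, phases]
  ring

theorem sq_expect_norm_dft_mulDeriv_affine_mul_card_range_le {f : G → ℂ} (hf : ∀ x, ‖f x‖ ≤ 1)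
    (T : G →+ AddChar G ℂ) (β : AddChar G ℂ) :
    (𝔼 h, ‖dft (mulDeriv f h) (T h + β)‖ ^ 2) ^ 2 * Nat.card (bicharFlip T - T).range ≤ 1 := by
  set E : ℝ := 𝔼 h, ‖dft (mulDeriv f h) (T h + β)‖ ^ 2
  set S := bicharFlip T - T
  set F : G → G → ℂ := fun u x => f x * f (u - x) * (T x (x - u) * β (-x))
  set F' : G → G → ℂ := fun u y =>
    conj (f y) * conj (f (u - y)) * (T y (u - y) * β (u - y))
  have E_eq : (E : ℂ) = 𝔼 u, 𝔼 x, 𝔼 y, F u x * F' u y * S y x :=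
    expect_norm_dft_mulDeriv_affine_sq f T β
  have norm_F_le (u x : G) : ‖F u x‖ ≤ 1 := by
    simpa [F] using mul_le_one₀ (hf x) (norm_nonneg _) (hf (u - x))
  have norm_F'_le (u y : G) : ‖F' u y‖ ≤ 1 := by
    simpa [F'] using mul_le_one₀ (hf y) (norm_nonneg _) (hf (u - y))
  calc E ^ 2 * Nat.card S.range
      = ‖𝔼 u, 𝔼 x, 𝔼 y, F u x * F' u y * S y x‖ ^ 2 * Nat.card S.range := by
        rw [← E_eq, Complex.norm_real, Real.norm_eq_abs, sq_abs]
    _ ≤ (𝔼 u, ‖𝔼 x, 𝔼 y, F u x * F' u y * S y x‖ ^ 2) * Nat.card S.range := by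
        gcongr
        exact norm_expect_sq_le _
    _ = 𝔼 u, ‖𝔼 x, 𝔼 y, F u x * F' u y * S y x‖ ^ 2 * Nat.card S.range := expect_mul ..
    _ ≤ 1 := expect_le univ_nonempty fun u _ =>
        norm_expect_mul_mul_apply_sq_mul_card_range_le (norm_F_le u) (norm_F'_le u) S

theorem exists_expect_norm_dft_mulDeriv_le_of_symm {f : G → ℂ} (hf : ∀ x, ‖f x‖ ≤ 1)
    {Q : G →+ AddChar G ℂ} (hQ : ∀ x y, Q x y = Q y x) (β : AddChar G ℂ) :
    ∃ ψ : AddChar G ℂ, 𝔼 h, ‖dft (mulDeriv f h) ((2 • Q) h + β)‖ ^ 2 ≤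
      ‖𝔼 x, f x * (Q x x * ψ x)‖ := by
  set a : G → ℂ := fun x => f x * (Q x x * β (-x)) with ha
  set b : G → ℂ := fun x => conj (f x) * Q x (-x) with hb
  set c : G → ℂ := fun x => conj (f x) * (Q x (-x) * β x) with hc
  set d : G → ℂ := fun x => f x * Q x x with hd
  obtain ⟨ξ, hξ⟩ := exists_norm_boxAvg_le_norm_dft a (b := b) (c := c) (d := d)
    (fun x => by simpa [hb] using hf x) (fun x => by simpa [hc] using hf x)
    (fun x => by simpa [hd] using hf x)
  have dft_a : dft a ξ = 𝔼 x, f x * (Q x x * (-β - ξ) x) := by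
    refine expect_congr rfl fun x _ => ?_
    rw [AddChar.sub_apply, AddChar.neg_apply]
    simp only [ha, mul_assoc]
  have box_eq : ((𝔼 h, ‖dft (mulDeriv f h) ((2 • Q) h + β)‖ ^ 2 : ℝ) : ℂ) = boxAvg a b c d := by
    simp only [Complex.ofReal_expect, norm_dft_mulDeriv_sq]
    rw [expect_comm]
    refine expect_congr rfl fun x _ => expect_congr rfl fun h _ => expect_congr rfl fun k _ => ?_
    have polarization : ((2 • Q) h + β) k = Q x x * β (-x) * Q (x + h) (-(x + h)) *
        (Q (x + k) (-(x + k)) * β (x + k)) * Q (x + h + k) (x + h + k) := by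
      simp only [two_nsmul, AddMonoidHom.add_apply, map_add, AddChar.add_apply,
        AddChar.map_add_eq_mul, AddChar.map_neg_eq_inv]
      rw [hQ h x, hQ k x, hQ k h]
      have ne (ψ : AddChar G ℂ) (z : G) : ψ z ≠ 0 := (ψ.val_isUnit z).ne_zero
      field_simp [ne]
    simp only [ha, hb, hc, hd, polarization, add_right_comm x k h]
    ring
  refine ⟨-β - ξ, ?_⟩
  calc 𝔼 h, ‖dft (mulDeriv f h) ((2 • Q) h + β)‖ ^ 2
      = ‖((𝔼 h, ‖dft (mulDeriv f h) ((2 • Q) h + β)‖ ^ 2 : ℝ) : ℂ)‖ := by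
        rw [Complex.norm_real, Real.norm_of_nonneg (expect_nonneg fun _ _ => by positivity)]
    _ ≤ _ := by rwa [box_eq, ← dft_a]

theorem exists_expect_apply_le_card_range_mul {H : Type*} [AddCommGroup H] {S : G →+ H}
    {w : G → H → ℝ} (hw : ∀ h z, 0 ≤ w h z) :
    ∃ z, 𝔼 h, w h (S h) ≤ Nat.card S.range * 𝔼 h, w h z := by
  classical
  have apply_le_sum : 𝔼 h, w h (S h) ≤ ∑ z : S.range, 𝔼 h, w h z := by
    rw [← expect_sum_comm]
    exact expect_le_expect fun h _ => single_le_sum (f := fun z : S.range => w h z)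
      (fun z _ => hw h z) (mem_univ (⟨S h, h, rfl⟩ : S.range))
  obtain ⟨z, -, hz⟩ := univ.exists_max_image (fun z : S.range => 𝔼 h, w h z) univ_nonempty
  refine ⟨z, apply_le_sum.trans ?_⟩
  rw [Nat.card_eq_fintype_card, ← nsmul_eq_mul]
  exact sum_le_card_nsmul univ _ _ hz

theorem exists_range_expect_norm_dft_mulDeriv_le {f : G → ℂ} {m : ℕ}
    (hm : ∀ ψ : AddChar G ℂ, (4 * m) • ψ = ψ) (T : G →+ AddChar G ℂ) (β : AddChar G ℂ) :
    ∃ γ, 𝔼 h, ‖dft (mulDeriv f h) (T h + β)‖ ^ 2 ≤ Nat.card (bicharFlip T - T).range *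
      𝔼 h, ‖dft (mulDeriv f h) ((2 • m • (T + bicharFlip T)) h + γ)‖ ^ 2 := by
  set S := bicharFlip T - T with hS
  have symmetrize (h : G) :
      T h + β = (2 • m • (T + bicharFlip T)) h + (β - (2 * m) • S h) := by
    conv_lhs => rw [← hm (T h)]
    simp only [hS, AddMonoidHom.nsmul_apply, AddMonoidHom.add_apply, AddMonoidHom.sub_apply]
    module
  obtain ⟨z, hz⟩ := exists_expect_apply_le_card_range_mul (S := S) fun h z =>
    sq_nonneg ‖dft (mulDeriv f h) ((2 • m • (T + bicharFlip T)) h + (β - (2 * m) • z))‖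
  simp only [← symmetrize] at hz
  exact ⟨_, hz⟩

theorem exists_symm_pow_three_le_norm_expect_mul_quadratic {f : G → ℂ} (hf : ∀ x, ‖f x‖ ≤ 1)
    {m : ℕ} (hm : ∀ ψ : AddChar G ℂ, (4 * m) • ψ = ψ) (T : G →+ AddChar G ℂ) (β : AddChar G ℂ) :
    ∃ (Q : G →+ AddChar G ℂ) (ψ : AddChar G ℂ), (∀ x y, Q x y = Q y x) ∧
      (𝔼 h, ‖dft (mulDeriv f h) (T h + β)‖ ^ 2) ^ 3 ≤ ‖𝔼 x, f x * (Q x x * ψ x)‖ := by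
  set E := 𝔼 h, ‖dft (mulDeriv f h) (T h + β)‖ ^ 2
  have : 0 ≤ E := expect_nonneg fun h _ => by positivity
  obtain ⟨γ, hγ⟩ := exists_range_expect_norm_dft_mulDeriv_le (f := f) hm T β
  set Q := m • (T + bicharFlip T)
  have Q_symm (x y : G) : Q x y = Q y x := by
    simp [Q, AddChar.nsmul_apply, bicharFlip_apply_apply, mul_comm]
  obtain ⟨ψ, hψ⟩ := exists_expect_norm_dft_mulDeriv_le_of_symm hf Q_symm γ
  refine ⟨Q, ψ, Q_symm, le_trans ?_ hψ⟩
  set E' := 𝔼 h, ‖dft (mulDeriv f h) ((2 • Q) h + γ)‖ ^ 2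
  have E'_nonneg : 0 ≤ E' := expect_nonneg fun h _ => by positivity
  calc E ^ 3 = E ^ 2 * E := by ring
    _ ≤ E ^ 2 * (Nat.card (bicharFlip T - T).range * E') :=
        mul_le_mul_of_nonneg_left hγ (sq_nonneg E)
    _ = E ^ 2 * Nat.card (bicharFlip T - T).range * E' := by ring
    _ ≤ 1 * E' := mul_le_mul_of_nonneg_right
        (sq_expect_norm_dft_mulDeriv_affine_mul_card_range_le hf T β) E'_nonneg
    _ = E' := one_mul _

end Bicharacters

section InverseTheorem

open Finset
open scoped Combinatorics.Additive ComplexConjugate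

theorem card_div_card_mul_le_expect_ite {ι : Type*} [Fintype ι] [DecidableEq ι] {B : Finset ι}
    {a : ℝ} {w : ι → ℝ} (hw : ∀ i ∈ B, a ≤ w i) :
    #B / Fintype.card ι * a ≤ 𝔼 i, if i ∈ B then w i else 0 := by
  rw [Fintype.expect_eq_sum_div_card, sum_ite_mem, univ_inter, div_mul_eq_mul_div, ← nsmul_eq_mul]
  gcongr
  exact card_nsmul_le_sum B w a hw

theorem half_mul_card_le_card_filter {ι : Type*} [Fintype ι] [Nonempty ι] {η : ℝ} {w : ι → ℝ}
    (hw : ∀ i, w i ≤ 1) (hη : 0 ≤ η) (hηw : η ≤ 𝔼 i, w i) :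
    η / 2 * Fintype.card ι ≤ #{i | η / 2 ≤ w i} := by
  have hcard : (0 : ℝ) < Fintype.card ι := by exact_mod_cast Fintype.card_pos
  have w_le (i : ι) : w i ≤ (if η / 2 ≤ w i then 1 else 0) + η / 2 := by
    split_ifs with hi
    · linarith [hw i]
    · linarith
  have := hηw.trans (expect_le_expect fun i _ => w_le i)
  rw [expect_add_distrib, Fintype.expect_const, Fintype.expect_eq_sum_div_card, sum_boole] at this
  rw [← le_div_iff₀ hcard]
  linarith

theorem exists_four_mul_nsmul_eq (p : ℕ) [Fact p.Prime] (hp : p ≠ 2) : ∃ m : ℕ,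
    ∀ {V : Type*} [AddCommGroup V] [Module (ZMod p) V] (v : V), (4 * m) • v = v := by
  have two_ne_zero : (2 : ZMod p) ≠ 0 := by
    rw [Ne, ← Nat.cast_two, ZMod.natCast_eq_zero_iff]
    exact fun h => hp ((Nat.prime_dvd_prime_iff_eq Fact.out Nat.prime_two).1 h)
  refine ⟨((4 : ZMod p)⁻¹).val, fun v => ?_⟩
  have four_ne_zero : (4 : ZMod p) ≠ 0 := by
    rw [show (4 : ZMod p) = 2 * 2 by norm_num]
    exact mul_ne_zero two_ne_zero two_ne_zero
  rw [← Nat.cast_smul_eq_nsmul (ZMod p)]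
  simp [four_ne_zero]

/-- The `ZMod p`-module structure on the dual group of a `ZMod p`-module, for speaking of characters
that depend linearly on a vector. It is put in scope by `let` where needed, not as an instance. -/
abbrev charModule (p : ℕ) (V : Type*) [AddCommGroup V] [Module (ZMod p) V] :
    Module (ZMod p) (AddChar V ℂ) :=
  AddCommGroup.zmodModule fun ψ => by
    ext v
    rw [AddChar.nsmul_apply, ← AddChar.map_nsmul_eq_pow, ZModModule.char_nsmul_eq_zero p,
      AddChar.map_zero_eq_one, AddChar.zero_apply]

/-- The set of directions in which the derivative of `f` has a Fourier coefficient of size at least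
`a` at `φ`. -/
def largeDerivDirections {G : Type*} [AddCommGroup G] [Fintype G] (f : G → ℂ)
    (φ : G → AddChar G ℂ) (a : ℝ) : Finset G :=
  {h | a ≤ ‖dft (mulDeriv f h) (φ h)‖}

theorem mul_sq_le_expect_of_subset_largeDerivDirections {G : Type*} [AddCommGroup G] [Fintype G]
    [DecidableEq G] {f : G → ℂ} {φ : G → AddChar G ℂ} {a b : ℝ} (ha : 0 ≤ a) {B : Finset G}
    (hB : B ⊆ largeDerivDirections f φ a) (hb : b * Fintype.card G ≤ #B) :
    b * a ^ 2 ≤ 𝔼 h, if h ∈ B then ‖dft (mulDeriv f h) (φ h)‖ ^ 2 else 0 := by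
  have hcard : (0 : ℝ) < Fintype.card G := by exact_mod_cast Fintype.card_pos
  have le_coeff_sq (h : G) (hh : h ∈ B) : a ^ 2 ≤ ‖dft (mulDeriv f h) (φ h)‖ ^ 2 :=
    pow_le_pow_left₀ ha (mem_filter.1 (hB hh)).2 2
  refine le_trans ?_ (card_div_card_mul_le_expect_ite le_coeff_sq)
  gcongr
  rwa [le_div_iff₀ hcard]

theorem exists_affine_le_expect_norm_dft_mulDeriv (p : ℕ) [Fact p.Prime] {η : ℝ} (hη : 0 < η) :
    ∃ c : ℝ, 0 < c ∧ ∀ (V : Type*) [AddCommGroup V] [Module (ZMod p) V] [Fintype V] (f : V → ℂ),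
      (∀ x, ‖f x‖ ≤ 1) → η ≤ ‖gowersU3Avg f‖ →
      ∃ (T : V →+ AddChar V ℂ) (β : AddChar V ℂ),
        c ≤ 𝔼 h, ‖dft (mulDeriv f h) (T h + β)‖ ^ 2 := by
  obtain ⟨c, hc_pos, hc⟩ := exists_affine_of_addEnergy p
    (κ := (η / 2 * (η / 2) ^ 2) ^ 4) (by positivity)
  refine ⟨c * (η / 2) * (η / 2) ^ 2, by positivity, fun V _ _ _ f hf hfη => ?_⟩
  classical
  let := charModule p V
  obtain ⟨φ, hφ⟩ := exists_norm_gowersU3Avg_le hf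
  set A := largeDerivDirections f φ (η / 2)
  have : (0 : ℝ) < Fintype.card V := by exact_mod_cast Fintype.card_pos
  have card_A : η / 2 * Fintype.card V ≤ #A := half_mul_card_le_card_filter
    (fun h => norm_dft_le_one (norm_mulDeriv_le_one hf h) _) hη.le (hfη.trans hφ)
  have A_nonempty : A.Nonempty := card_pos.1 <| by
    exact_mod_cast (by positivity : 0 < η / 2 * Fintype.card V).trans_le card_A
  have card_A_le : (#A : ℝ) ≤ Fintype.card V := by exact_mod_cast card_le_univ A
  have large_on_A := mul_sq_le_expect_of_subset_largeDerivDirections (a := η / 2) (by positivity)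
    (subset_refl A) card_A
  have energy_graph :
      (η / 2 * (η / 2) ^ 2) ^ 4 * (#A : ℝ) ^ 3 ≤ E[A.image fun x => (x, φ x)] := by
    refine le_trans ?_ (expect_norm_dft_mulDeriv_pow_four_le_addEnergy hf φ A)
    exact mul_le_mul (pow_le_pow_left₀ (by positivity) large_on_A 4)
      (pow_le_pow_left₀ (by positivity) card_A_le 3) (by positivity)
      (Even.pow_nonneg (by decide) _)
  obtain ⟨T, β, hT⟩ := hc V (AddChar V ℂ) φ A A_nonempty energy_graph
  refine ⟨T.toAddMonoidHom, β, (mul_sq_le_expect_of_subset_largeDerivDirections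
    (B := {x ∈ A | φ x = T.toAddMonoidHom x + β}) (by positivity) (filter_subset _ _) ?_).trans
      (expect_le_expect fun h _ => ?_)⟩
  · calc c * (η / 2) * Fintype.card V = c * (η / 2 * Fintype.card V) := by ring
      _ ≤ c * #A := by gcongr
      _ ≤ _ := hT
  · split_ifs with hh
    · rw [(mem_filter.1 hh).2]
    · positivity

/-- The **inverse theorem for the `U³` norm**, due to Green and Tao. -/
theorem exists_le_norm_expect_mul_quadratic_of_le_gowersU3Avg (p : ℕ) [Fact p.Prime] (hp : p ≠ 2)
    {η : ℝ} (hη : 0 < η) :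
    ∃ c : ℝ, 0 < c ∧ ∀ (V : Type*) [AddCommGroup V] [Module (ZMod p) V] [Fintype V] (f : V → ℂ),
      (∀ x, ‖f x‖ ≤ 1) → η ≤ ‖gowersU3Avg f‖ →
      ∃ (Q : V →+ AddChar V ℂ) (ψ : AddChar V ℂ), (∀ x y, Q x y = Q y x) ∧
        c ≤ ‖𝔼 x, f x * (Q x x * ψ x)‖ := by
  obtain ⟨c, hc_pos, hc⟩ := exists_affine_le_expect_norm_dft_mulDeriv p hη
  obtain ⟨m, hm⟩ := exists_four_mul_nsmul_eq p hp
  refine ⟨c ^ 3, by positivity, fun V _ _ _ f hf hfη => ?_⟩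
  let := charModule p V
  obtain ⟨T, β, hT⟩ := hc V f hf hfη
  obtain ⟨Q, ψ, Q_symm, hQ⟩ := exists_symm_pow_three_le_norm_expect_mul_quadratic hf hm T β
  exact ⟨Q, ψ, Q_symm, (pow_le_pow_left₀ hc_pos.le hT 3).trans hQ⟩

end InverseTheorem

section QuadraticPhases

open Finset Matrix
open scoped ComplexConjugate

variable {p : ℕ} [NeZero p] {ι : Type*} [Fintype ι]

/-- The character `x ↦ exp(2πi rᵀx / p)` of `(ℤ/p)^ι` with frequency `r`. -/
def dotChar (r : ι → ZMod p) : AddChar (ι → ZMod p) ℂ where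
  toFun x := ZMod.stdAddChar (r ⬝ᵥ x)
  map_zero_eq_one' := by rw [dotProduct_zero, AddChar.map_zero_eq_one]
  map_add_eq_mul' x y := by rw [dotProduct_add, AddChar.map_add_eq_mul]

theorem dotChar_apply (r x : ι → ZMod p) : dotChar r x = ZMod.stdAddChar (r ⬝ᵥ x) := rfl

theorem dotChar_add (r s : ι → ZMod p) : dotChar (r + s) = dotChar r + dotChar s := by
  ext x
  rw [AddChar.add_apply, dotChar_apply, add_dotProduct, AddChar.map_add_eq_mul, dotChar_apply,
    dotChar_apply]

theorem dotChar_bijective : Function.Bijective (dotChar : (ι → ZMod p) → AddChar _ ℂ) := by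
  classical
  refine (Fintype.bijective_iff_injective_and_card _).2 ⟨fun r s hrs => ?_, ?_⟩
  · refine dotProduct_eq _ _ fun x => ZMod.injective_stdAddChar ?_
    rw [← dotChar_apply, ← dotChar_apply, hrs]
  · exact (AddChar.card_eq (α := ι → ZMod p)).symm

/-- The identification of `(ℤ/p)^ι` with its dual group, through the dot product. -/
def dotCharEquiv : (ι → ZMod p) ≃+ AddChar (ι → ZMod p) ℂ :=
  AddEquiv.mk' (Equiv.ofBijective dotChar dotChar_bijective) dotChar_add

theorem exists_isSymm_apply_eq_stdAddChar {Q : (ι → ZMod p) →+ AddChar (ι → ZMod p) ℂ}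
    (Q_symm : ∀ x y, Q x y = Q y x) :
    ∃ M : Matrix ι ι (ZMod p), M.IsSymm ∧ ∀ x y, Q x y = ZMod.stdAddChar (y ⬝ᵥ M *ᵥ x) := by
  classical
  let T := (dotCharEquiv.symm.toAddMonoidHom.comp Q).toZModLinearMap p
  have apply_eq (x y : ι → ZMod p) :
      Q x y = ZMod.stdAddChar (y ⬝ᵥ LinearMap.toMatrix' T *ᵥ x) := by
    have frequency : dotChar (T x) = Q x := dotCharEquiv.apply_symm_apply (Q x)
    rw [LinearMap.toMatrix'_mulVec, dotProduct_comm, ← dotChar_apply, frequency]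
  refine ⟨LinearMap.toMatrix' T, ?_, apply_eq⟩
  ext i j
  have entry_eq := ZMod.injective_stdAddChar
    (((apply_eq _ _).symm.trans (Q_symm (Pi.single i 1) (Pi.single j 1))).trans (apply_eq _ _))
  simpa using entry_eq

instance fact_prime_five : Fact (Nat.Prime 5) := ⟨Nat.prime_five⟩

variable {n : ℕ}

theorem ofReal_gowersU3Pow (f : F5n n → ℝ) :
    (gowersU3Pow f : ℂ) = gowersU3Avg fun x => (f x : ℂ) := by
  rw [gowersU3Pow, expect_comm, gowersU3Avg]
  simp only [Complex.ofReal_expect, boxAvg, mulDeriv, map_mul, Complex.conj_ofReal]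
  refine expect_congr rfl fun h _ => expect_congr rfl fun x _ => expect_congr rfl fun k _ =>
    expect_congr rfl fun l _ => ?_
  rw [add_right_comm x k h, add_right_comm x l h, add_right_comm (x + k) l h, add_right_comm x k h]
  push_cast
  ring

theorem exists_le_norm_expect_mul_stdAddChar_of_le_gowersU3Pow {η : ℝ} (hη : 0 < η) :
    ∃ c : ℝ, 0 < c ∧ ∀ (n : ℕ) (f : F5n n → ℝ), (∀ x, |f x| ≤ 1) → η ≤ gowersU3Pow f →
      ∃ (M : Matrix (Fin n) (Fin n) (ZMod 5)) (r : F5n n), M.IsSymm ∧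
        c ≤ ‖𝔼 x, (f x : ℂ) * ZMod.stdAddChar (x ⬝ᵥ M *ᵥ x + r ⬝ᵥ x)‖ := by
  obtain ⟨c, hc_pos, hc⟩ :=
    exists_le_norm_expect_mul_quadratic_of_le_gowersU3Avg 5 (by norm_num) hη
  refine ⟨c, hc_pos, fun n f hf hfη => ?_⟩
  obtain ⟨Q, ψ, Q_symm, hQ⟩ := hc (F5n n) (fun x => (f x : ℂ))
    (fun x => (Complex.norm_real _).trans_le (hf x)) (by
      rw [← ofReal_gowersU3Pow, Complex.norm_real]
      exact hfη.trans (le_abs_self _))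
  obtain ⟨M, M_symm, hM⟩ := exists_isSymm_apply_eq_stdAddChar Q_symm
  obtain ⟨r, rfl⟩ := dotChar_bijective.surjective ψ
  refine ⟨M, r, M_symm, hQ.trans_eq ?_⟩
  simp only [hM, dotChar_apply, AddChar.map_add_eq_mul]

end QuadraticPhases

section CondAvg

open Finset

variable {n : ℕ} {f : F5n n → ℝ} {B B' : Setoid (F5n n)} {x y : F5n n}

open scoped Classical in
theorem filter_rel_eq_of_rel (h : B x y) :
    univ.filter (fun z => B x z) = univ.filter (fun z => B y z) :=
  filter_congr fun _ _ => ⟨fun hx => B.trans (B.symm h) hx, fun hy => B.trans h hy⟩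

theorem condAvg_eq_of_rel (f : F5n n → ℝ) (h : B x y) : condAvg B f x = condAvg B f y := by
  rw [condAvg, condAvg, filter_rel_eq_of_rel h]

theorem abs_condAvg_le_one (B : Setoid (F5n n)) (hf : ∀ x, |f x| ≤ 1) (x : F5n n) :
    |condAvg B f x| ≤ 1 := by
  classical
  exact (abs_expect_le _ _).trans
    (expect_le ⟨x, mem_filter.2 ⟨mem_univ x, B.refl x⟩⟩ fun y _ => hf y)

theorem sum_condAvg_smul {E : Type*} [AddCommGroup E] [Module ℝ E] (f : F5n n → ℝ)
    {u : F5n n → E} (hu : ∀ x y, B x y → u x = u y) :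
    ∑ x, condAvg B f x • u x = ∑ x, f x • u x := by
  classical
  let atom (x : F5n n) : Finset (F5n n) := {y | B x y}
  have card_atom_ne_zero (x : F5n n) : (#(atom x) : ℝ) ≠ 0 :=
    Nat.cast_ne_zero.2 (card_ne_zero_of_mem (mem_filter.2 ⟨mem_univ x, B.refl x⟩))
  calc ∑ x, condAvg B f x • u x
      = ∑ x, ∑ y, if B x y then (f y / #(atom x)) • u x else 0 :=
        sum_congr rfl fun x _ => by
          rw [condAvg, expect_eq_sum_div_card, sum_div, sum_smul, sum_filter]
    _ = ∑ y, ∑ x, if B y x then (f y / #(atom y)) • u y else 0 := by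
        rw [sum_comm]
        refine sum_congr rfl fun y _ => sum_congr rfl fun x _ => ?_
        by_cases h : B x y
        · rw [if_pos h, if_pos (B.symm h), hu x y h]
          simp only [atom, filter_rel_eq_of_rel h]
        · rw [if_neg h, if_neg fun h' => h (B.symm h')]
    _ = ∑ y, f y • u y := sum_congr rfl fun y _ => by
        rw [← sum_filter, sum_const, ← Nat.cast_smul_eq_nsmul ℝ, smul_smul,
          mul_div_cancel₀ _ (card_atom_ne_zero y)]

/-- The energy `‖𝔼(f | B)‖₂²` of `f` with respect to a factor, the quantity that increases along
the iteration. -/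
def factorEnergy (B : Setoid (F5n n)) (f : F5n n → ℝ) : ℝ :=
  𝔼 x, condAvg B f x ^ 2

theorem factorEnergy_nonneg (B : Setoid (F5n n)) (f : F5n n → ℝ) : 0 ≤ factorEnergy B f :=
  expect_nonneg fun _ _ => sq_nonneg _

theorem factorEnergy_le_one (B : Setoid (F5n n)) (hf : ∀ x, |f x| ≤ 1) : factorEnergy B f ≤ 1 :=
  expect_le univ_nonempty fun x _ => (sq_le_one_iff_abs_le_one _).2 (abs_condAvg_le_one B hf x)

theorem expect_condAvg_sub_sq (hB : B' ≤ B) (f : F5n n → ℝ) :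
    𝔼 x, (condAvg B' f x - condAvg B f x) ^ 2 = factorEnergy B' f - factorEnergy B f := by
  have cross_term_fine : ∑ x, condAvg B' f x * condAvg B f x = ∑ x, f x * condAvg B f x :=
    sum_condAvg_smul f fun _ _ h => condAvg_eq_of_rel f (hB h)
  have cross_term_coarse : ∑ x, condAvg B f x * condAvg B f x = ∑ x, f x * condAvg B f x :=
    sum_condAvg_smul f fun _ _ h => condAvg_eq_of_rel f h
  simp only [factorEnergy, Fintype.expect_eq_sum_div_card, ← sub_div]
  congr 1
  simp only [sub_sq, sum_add_distrib, sum_sub_distrib, mul_assoc, ← mul_sum, cross_term_fine,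
    ← cross_term_coarse, ← sq]
  ring

theorem factorEnergy_mono (hB : B' ≤ B) (f : F5n n → ℝ) : factorEnergy B f ≤ factorEnergy B' f :=
  sub_nonneg.1 <| (expect_nonneg fun _ _ => sq_nonneg _).trans_eq (expect_condAvg_sub_sq hB f)

theorem norm_expect_sub_condAvg_mul_sq_le (hB : B' ≤ B) (f : F5n n → ℝ) {u : F5n n → ℂ}
    (hu_le : ∀ x, ‖u x‖ ≤ 1) (hu : ∀ x y, B' x y → u x = u y) :
    ‖𝔼 x, ((f x - condAvg B f x : ℝ) : ℂ) * u x‖ ^ 2 ≤ factorEnergy B' f - factorEnergy B f := by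
  have project : 𝔼 x, ((f x - condAvg B f x : ℝ) : ℂ) * u x =
      𝔼 x, u x * ((condAvg B' f x - condAvg B f x : ℝ) : ℂ) := by
    simp only [Fintype.expect_eq_sum_div_card, mul_comm (u _), ← Complex.real_smul, sub_smul,
      sum_sub_distrib, sum_condAvg_smul f hu]
  rw [project, ← expect_condAvg_sub_sq hB]
  refine (norm_expect_mul_sq_le hu_le _).trans_eq ?_
  simp only [Complex.norm_real, Real.norm_eq_abs, sq_abs]

end CondAvg

section QuadraticForms

open Matrix

variable {R κ ι : Type*} [CommSemiring R] [Fintype κ]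

theorem isSymm_sum_smul (c : κ → R) {M : κ → Matrix ι ι R} (hM : ∀ j, (M j).IsSymm) :
    (∑ j, c j • M j).IsSymm := by
  rw [IsSymm, transpose_sum]
  exact Finset.sum_congr rfl fun j _ => (hM j).smul (c j)

variable [Fintype ι]

theorem dotProduct_sum_smul_mulVec (c : κ → R) (M : κ → Matrix ι ι R) (x y : ι → R) :
    x ⬝ᵥ (∑ j, c j • M j) *ᵥ y = ∑ j, c j * (x ⬝ᵥ M j *ᵥ y) := by
  simp only [sum_mulVec, dotProduct_sum, smul_mulVec, dotProduct_smul, smul_eq_mul]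

theorem dotProduct_mulVec_self_eq_of_mulVec_eq {S : Matrix ι ι R} (hS : S.IsSymm) {x y : ι → R}
    (hxy : S *ᵥ x = S *ᵥ y) : x ⬝ᵥ S *ᵥ x = y ⬝ᵥ S *ᵥ y := by
  rw [hxy, dotProduct_mulVec, ← mulVec_transpose, hS.eq, hxy, dotProduct_comm]

theorem exists_rank_forms_determine_mulVec {K m : Type*} [Field K] [Finite m]
    (S : Matrix m ι K) :
    ∃ v : Fin S.rank → ι → K, ∀ x y, (∀ i, v i ⬝ᵥ x = v i ⬝ᵥ y) → S *ᵥ x = S *ᵥ y := by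
  classical
  let b : Module.Basis (Fin S.rank) K (LinearMap.range S.mulVecLin) :=
    Module.finBasisOfFinrankEq K _ rfl
  let form (i : Fin S.rank) : Module.Dual K (ι → K) := b.coord i ∘ₗ S.mulVecLin.rangeRestrict
  have dotProduct_form (i : Fin S.rank) (x : ι → K) :
      (dotProductEquiv K ι).symm (form i) ⬝ᵥ x = form i x :=
    LinearMap.congr_fun ((dotProductEquiv K ι).apply_symm_apply (form i)) x
  refine ⟨fun i => (dotProductEquiv K ι).symm (form i), fun x y hxy => ?_⟩
  simp only [dotProduct_form] at hxy
  exact congrArg Subtype.val (b.ext_elem hxy)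

end QuadraticForms

namespace QuadraticFactor

open Matrix
open scoped NNReal

variable {n d₁ d₂ e₁ e₂ k₁ k₂ : ℕ} {x y : F5n n}

theorem Refines.rfl {Q : QuadraticFactor n d₁ d₂} : Q.Refines Q := ⟨le_rfl, le_rfl⟩

theorem Refines.trans {Q : QuadraticFactor n d₁ d₂} {Q' : QuadraticFactor n e₁ e₂}
    {Q'' : QuadraticFactor n k₁ k₂} (h : Q.Refines Q') (h' : Q'.Refines Q'') : Q.Refines Q'' :=
  ⟨h.1.trans h'.1, h.2.trans h'.2⟩

theorem B₁_rel {Q : QuadraticFactor n d₁ d₂} : Q.B₁ x y ↔ ∀ j, Q.r j ⬝ᵥ x = Q.r j ⬝ᵥ y := by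
  change Q.linMap x = Q.linMap y ↔ _
  simp only [funext_iff, linMap]

theorem B₂_rel {Q : QuadraticFactor n d₁ d₂} :
    Q.B₂ x y ↔ (∀ j, Q.r j ⬝ᵥ x = Q.r j ⬝ᵥ y) ∧ ∀ j, x ⬝ᵥ Q.M j *ᵥ x = y ⬝ᵥ Q.M j *ᵥ y := by
  change (Q.linMap x, Q.quadMap x) = (Q.linMap y, Q.quadMap y) ↔ _
  simp only [Prod.mk.injEq, funext_iff, linMap, quadMap]

/-- The factor obtained by adding one vector and one matrix. -/
def extend (Q : QuadraticFactor n d₁ d₂) (r : F5n n) (M : Matrix (Fin n) (Fin n) (ZMod 5))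
    (hM : M.IsSymm) : QuadraticFactor n (d₁ + 1) (d₂ + 1) where
  r := Fin.snoc Q.r r
  M := Fin.snoc Q.M M
  symm := Fin.lastCases (by simpa only [Fin.snoc_last] using hM)
    fun i => by simpa only [Fin.snoc_castSucc] using Q.symm i

section Extend

variable (Q : QuadraticFactor n d₁ d₂) {r : F5n n} {M : Matrix (Fin n) (Fin n) (ZMod 5)}
  (hM : M.IsSymm)

theorem extend_B₁_rel : (Q.extend r M hM).B₁ x y ↔ Q.B₁ x y ∧ r ⬝ᵥ x = r ⬝ᵥ y := by
  simp only [B₁_rel, extend, Fin.forall_fin_succ', Fin.snoc_castSucc, Fin.snoc_last]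

theorem extend_B₂_rel : (Q.extend r M hM).B₂ x y ↔
    Q.B₂ x y ∧ r ⬝ᵥ x = r ⬝ᵥ y ∧ x ⬝ᵥ M *ᵥ x = y ⬝ᵥ M *ᵥ y := by
  simp only [B₂_rel, extend, Fin.forall_fin_succ', Fin.snoc_castSucc, Fin.snoc_last]
  tauto

theorem extend_refines : (Q.extend r M hM).Refines Q :=
  ⟨fun _ _ h => ((Q.extend_B₁_rel hM).1 h).1, fun _ _ h => ((Q.extend_B₂_rel hM).1 h).1⟩

end Extend

/-- The factor obtained by adding the vectors `v` and removing the matrix with index `j₀`. -/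
def replaceMatrix {k : ℕ} (Q : QuadraticFactor n d₁ (d₂ + 1)) (j₀ : Fin (d₂ + 1))
    (v : Fin k → F5n n) : QuadraticFactor n (d₁ + k) d₂ where
  r := Fin.append Q.r v
  M i := Q.M (j₀.succAbove i)
  symm i := Q.symm (j₀.succAbove i)

theorem replaceMatrix_r_eq_iff {k : ℕ} (Q : QuadraticFactor n d₁ (d₂ + 1)) (j₀ : Fin (d₂ + 1))
    (v : Fin k → F5n n) :
    (∀ j, (Q.replaceMatrix j₀ v).r j ⬝ᵥ x = (Q.replaceMatrix j₀ v).r j ⬝ᵥ y) ↔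
      (∀ j, Q.r j ⬝ᵥ x = Q.r j ⬝ᵥ y) ∧ ∀ i, v i ⬝ᵥ x = v i ⬝ᵥ y := by
  simp only [replaceMatrix, Fin.forall_fin_add, Fin.append_left, Fin.append_right]

/-- A quadratic form of rank `k` is a function of `k` linear forms, which can therefore replace one
of the matrices occurring in the combination. -/
theorem exists_refines_of_combination (Q : QuadraticFactor n d₁ (d₂ + 1))
    {c : Fin (d₂ + 1) → ZMod 5} (hc : c ≠ 0) :
    ∃ Q' : QuadraticFactor n (d₁ + (∑ j, c j • Q.M j).rank) d₂, Q'.Refines Q := by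
  obtain ⟨j₀, hj₀⟩ := Function.ne_iff.1 hc
  obtain ⟨v, hv⟩ := exists_rank_forms_determine_mulVec (∑ j, c j • Q.M j)
  refine ⟨Q.replaceMatrix j₀ v, fun x y h => ?_, fun x y h => ?_⟩
  · exact B₁_rel.2 ((Q.replaceMatrix_r_eq_iff j₀ v).1 (B₁_rel.1 h)).1
  · obtain ⟨linear_eq, others_eq⟩ := B₂_rel.1 h
    obtain ⟨linear_eq, forms_eq⟩ := (Q.replaceMatrix_r_eq_iff j₀ v).1 linear_eq
    have combination_eq := dotProduct_mulVec_self_eq_of_mulVec_eq (isSymm_sum_smul c Q.symm)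
      (hv x y forms_eq)
    have quad_eq (i : Fin d₂) : x ⬝ᵥ Q.M (j₀.succAbove i) *ᵥ x =
        y ⬝ᵥ Q.M (j₀.succAbove i) *ᵥ y := others_eq i
    rw [dotProduct_sum_smul_mulVec, dotProduct_sum_smul_mulVec, Fin.sum_univ_succAbove _ j₀,
      Fin.sum_univ_succAbove _ j₀] at combination_eq
    simp only [quad_eq, add_left_inj] at combination_eq
    refine B₂_rel.2 ⟨linear_eq, (Fin.forall_iff_succAbove j₀).2
      ⟨mul_left_cancel₀ hj₀ combination_eq, quad_eq⟩⟩

theorem exists_refines_rankAtLeast (ω : ℝ≥0 → ℝ) (d₁ d₂ : ℕ) :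
    ∃ D : ℕ, ∀ (n : ℕ) (Q : QuadraticFactor n d₁ d₂),
      ∃ (e₁ e₂ : ℕ) (Q' : QuadraticFactor n e₁ e₂), Q'.Refines Q ∧ e₁ ≤ D ∧ e₂ ≤ D ∧
        Q'.RankAtLeast (ω ((e₁ + e₂ : ℕ) : ℝ≥0)) := by
  induction d₂ generalizing d₁ with
  | zero =>
    exact ⟨d₁, fun n Q => ⟨d₁, 0, Q, Refines.rfl, le_rfl, Nat.zero_le _,
      fun c hc => absurd (Subsingleton.elim c 0) hc⟩⟩
  | succ d₂ ih =>
    choose D hD using ih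
    set t := ω ((d₁ + (d₂ + 1) : ℕ) : ℝ≥0)
    obtain ⟨D_max, le_D_max⟩ := ((Set.finite_Iic ⌈t⌉₊).image fun k => D (d₁ + k)).bddAbove
    refine ⟨d₁ + d₂ + 1 + D_max, fun n Q => ?_⟩
    by_cases hQ : Q.RankAtLeast t
    · exact ⟨d₁, d₂ + 1, Q, Refines.rfl, by omega, by omega, hQ⟩
    · simp only [RankAtLeast, not_forall, not_le] at hQ
      obtain ⟨c, hc, rank_lt⟩ := hQ
      obtain ⟨Q', hQ'⟩ := Q.exists_refines_of_combination hc
      obtain ⟨e₁, e₂, Q'', hQ'', he₁, he₂, rank_le⟩ := hD _ n Q'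
      have le_max := le_D_max (Set.mem_image_of_mem _ (Set.mem_Iic.2
        (Nat.cast_le.1 (rank_lt.le.trans (Nat.le_ceil t)))))
      exact ⟨e₁, e₂, Q'', hQ''.trans hQ', by omega, by omega, rank_le⟩

end QuadraticFactor

section Regularity

open Finset Matrix

theorem gowersU3Pow_const_mul {n : ℕ} (c : ℝ) (f : F5n n → ℝ) :
    gowersU3Pow (fun x => c * f x) = c ^ 8 * gowersU3Pow f := by
  simp only [gowersU3Pow, mul_expect]
  refine expect_congr rfl fun x _ => expect_congr rfl fun h _ => expect_congr rfl fun k _ =>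
    expect_congr rfl fun l _ => ?_
  ring

theorem gowersU3Norm_pow_eight {n : ℕ} (f : F5n n → ℝ) : gowersU3Norm f ^ 8 = gowersU3Pow f := by
  rw [gowersU3Norm, ← Real.rpow_natCast, ← Real.rpow_mul (gowersU3Pow_nonneg f)]
  norm_num

theorem exists_le_norm_expect_mul_stdAddChar_of_le_gowersU3Norm {ε R : ℝ} (hε : 0 < ε)
    (hR : 0 < R) :
    ∃ c : ℝ, 0 < c ∧ ∀ (n : ℕ) (f : F5n n → ℝ), (∀ x, |f x| ≤ R) → ε ≤ gowersU3Norm f →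
      ∃ (M : Matrix (Fin n) (Fin n) (ZMod 5)) (r : F5n n), M.IsSymm ∧
        c ≤ ‖𝔼 x, (f x : ℂ) * ZMod.stdAddChar (x ⬝ᵥ M *ᵥ x + r ⬝ᵥ x)‖ := by
  obtain ⟨c, hc_pos, hc⟩ :=
    exists_le_norm_expect_mul_stdAddChar_of_le_gowersU3Pow (η := R⁻¹ ^ 8 * ε ^ 8) (by positivity)
  refine ⟨R * c, by positivity, fun n f hf hfε => ?_⟩
  have normalized_le_one (x : F5n n) : |R⁻¹ * f x| ≤ 1 := by
    rw [abs_mul, abs_of_pos (inv_pos.2 hR), inv_mul_le_one₀ hR]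
    exact hf x
  have normalized_large : R⁻¹ ^ 8 * ε ^ 8 ≤ gowersU3Pow fun x => R⁻¹ * f x := by
    rw [gowersU3Pow_const_mul, ← gowersU3Norm_pow_eight]
    gcongr
  obtain ⟨M, r, M_symm, le_norm⟩ := hc n _ normalized_le_one normalized_large
  refine ⟨M, r, M_symm, ?_⟩
  simp only [Complex.ofReal_mul, mul_assoc, ← mul_expect] at le_norm
  rwa [norm_mul, Complex.norm_real, Real.norm_of_nonneg (inv_nonneg.2 hR.le), ← div_eq_inv_mul,
    le_div_iff₀' hR] at le_norm

theorem exists_energy_increment {ε : ℝ} (hε : 0 < ε) :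
    ∃ c : ℝ, 0 < c ∧ ∀ (n d₁ d₂ : ℕ) (f : F5n n → ℝ) (Q : QuadraticFactor n d₁ d₂),
      (∀ x, |f x| ≤ 1) → ε ≤ gowersU3Norm (f - condAvg Q.B₂ f) →
      ∃ Q' : QuadraticFactor n (d₁ + 1) (d₂ + 1), Q'.Refines Q ∧
        factorEnergy Q.B₂ f + c ≤ factorEnergy Q'.B₂ f := by
  obtain ⟨c, hc_pos, hc⟩ :=
    exists_le_norm_expect_mul_stdAddChar_of_le_gowersU3Norm hε (zero_lt_two' ℝ)
  refine ⟨c ^ 2, by positivity, fun n d₁ d₂ f Q hf hQ => ?_⟩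
  have abs_sub_le_two (x : F5n n) : |(f - condAvg Q.B₂ f) x| ≤ 2 :=
    (abs_sub _ _).trans (by linarith [hf x, abs_condAvg_le_one Q.B₂ hf x])
  obtain ⟨M, r, M_symm, le_norm⟩ := hc n _ abs_sub_le_two hQ
  have refines := Q.extend_refines (r := r) M_symm
  have le_energy_sub := norm_expect_sub_condAvg_mul_sq_le refines.2 f
    (u := fun x => ZMod.stdAddChar (x ⬝ᵥ M *ᵥ x + r ⬝ᵥ x)) (fun x => (AddChar.norm_apply _ _).le)
    fun x y h => by
      obtain ⟨-, linear_eq, quadratic_eq⟩ := (Q.extend_B₂_rel M_symm).1 h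
      rw [linear_eq, quadratic_eq]
  refine ⟨Q.extend r M M_symm, refines, ?_⟩
  linarith [(pow_le_pow_left₀ hc_pos.le le_norm 2).trans le_energy_sub]

/-- The **Koopman–von Neumann** (weak regularity) theorem for the `U³` norm. -/
theorem exists_refines_gowersU3Norm_le {ε : ℝ} (hε : 0 < ε) :
    ∃ K : ℕ, ∀ (n d₁ d₂ : ℕ) (f : F5n n → ℝ) (Q : QuadraticFactor n d₁ d₂), (∀ x, |f x| ≤ 1) →
      ∃ k ≤ K, ∃ Q' : QuadraticFactor n (d₁ + k) (d₂ + k), Q'.Refines Q ∧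
        gowersU3Norm (f - condAvg Q'.B₂ f) ≤ ε := by
  obtain ⟨c, hc_pos, hc⟩ := exists_energy_increment hε
  obtain ⟨K, hK⟩ := exists_nat_gt (1 / c)
  refine ⟨K, fun n d₁ d₂ f Q hf => ?_⟩
  by_contra! not_uniform
  have energy_grows (k : ℕ) (hk : k ≤ K) : ∃ Q' : QuadraticFactor n (d₁ + k) (d₂ + k),
      Q'.Refines Q ∧ k * c ≤ factorEnergy Q'.B₂ f := by
    induction k with
    | zero => exact ⟨Q, .rfl, by simpa using factorEnergy_nonneg Q.B₂ f⟩
    | succ k ih =>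
      obtain ⟨Q', hQ', energy_ge⟩ := ih (by omega)
      obtain ⟨Q'', hQ'', increment⟩ := hc n _ _ f Q' hf (not_uniform k (by omega) Q' hQ').le
      refine ⟨Q'', hQ''.trans hQ', ?_⟩
      push_cast
      linarith
  obtain ⟨Q', -, energy_ge⟩ := energy_grows K le_rfl
  have energy_le := factorEnergy_le_one Q'.B₂ hf
  rw [div_lt_iff₀ hc_pos] at hK
  linarith

namespace QuadraticFactor

variable {n d₁ d₂ : ℕ}

/-- The factor `Q` regularises `f`: its rank is large in terms of its complexity, and `f` differs
from its projection to `Q` by a function that is small in `L²` and one that is tiny in `U³`. -/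
structure IsRegular (δ : ℝ) (ω₁ ω₂ : ℝ≥0 → ℝ) (f : F5n n → ℝ) (Q : QuadraticFactor n d₁ d₂) :
    Prop where
  rankAtLeast : Q.RankAtLeast (ω₁ ((d₁ + d₂ : ℕ) : ℝ≥0))
  exists_decomposition : ∃ f₁ f₂ f₃ : F5n n → ℝ, f = f₁ + f₂ + f₃ ∧ f₁ = condAvg Q.B₂ f ∧
    l2Norm f₂ ≤ δ ∧ gowersU3Norm f₃ ≤ 1 / ω₂ ((d₁ + d₂ : ℕ) : ℝ≥0)

end QuadraticFactor

variable {δ : ℝ} {ω₂ : ℝ≥0 → ℝ}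

theorem exists_forall_le_of_le (C : ℕ → ℕ → ℕ) (D : ℕ) :
    ∃ B, ∀ a ≤ D, ∀ b ≤ D, C a b ≤ B := by
  obtain ⟨B, hB⟩ := ((Set.finite_Iic D).image2 C (Set.finite_Iic D)).bddAbove
  exact ⟨B, fun a ha b hb => hB (Set.mem_image2_of_mem ha hb)⟩

theorem exists_isRegular_or_energy_increment (hδ : 0 < δ) (ω₁ : ℝ≥0 → ℝ) (hω₂ : ∀ t, 0 < ω₂ t)
    (d₁ d₂ : ℕ) :
    ∃ D : ℕ, ∀ (n : ℕ) (f : F5n n → ℝ) (Q₀ : QuadraticFactor n d₁ d₂), (∀ x, |f x| ≤ 1) →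
      Q₀.RankAtLeast (ω₁ ((d₁ + d₂ : ℕ) : ℝ≥0)) →
      Q₀.IsRegular δ ω₁ ω₂ f ∨
      ∃ (e₁ e₂ : ℕ) (Q : QuadraticFactor n e₁ e₂), Q.Refines Q₀ ∧ e₁ ≤ D ∧ e₂ ≤ D ∧
        Q.RankAtLeast (ω₁ ((e₁ + e₂ : ℕ) : ℝ≥0)) ∧
        factorEnergy Q₀.B₂ f + δ ^ 2 < factorEnergy Q.B₂ f := by
  choose D hD using QuadraticFactor.exists_refines_rankAtLeast ω₁
  obtain ⟨K, hK⟩ := exists_refines_gowersU3Norm_le (one_div_pos.2 (hω₂ ((d₁ + d₂ : ℕ) : ℝ≥0)))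
  obtain ⟨D_max, le_D_max⟩ := exists_forall_le_of_le (fun k _ => D (d₁ + k) (d₂ + k)) K
  refine ⟨D_max, fun n f Q₀ hf hQ₀ => ?_⟩
  obtain ⟨k, hk, Q', hQ', uniform⟩ := hK n d₁ d₂ f Q₀ hf
  by_cases close : l2Norm (condAvg Q'.B₂ f - condAvg Q₀.B₂ f) ≤ δ
  · exact .inl ⟨hQ₀, condAvg Q₀.B₂ f, condAvg Q'.B₂ f - condAvg Q₀.B₂ f, f - condAvg Q'.B₂ f,
      by abel, rfl, close, uniform⟩
  · obtain ⟨e₁, e₂, Q, hQ, he₁, he₂, hQ_rank⟩ := hD (d₁ + k) (d₂ + k) n Q'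
    have D_le := le_D_max k hk k hk
    refine .inr ⟨e₁, e₂, Q, hQ.trans hQ', he₁.trans D_le, he₂.trans D_le, hQ_rank, ?_⟩
    have increment : δ ^ 2 < factorEnergy Q'.B₂ f - factorEnergy Q₀.B₂ f := by
      rw [← expect_condAvg_sub_sq hQ'.2]
      exact (Real.lt_sqrt hδ.le).1 (not_le.1 close)
    linarith [factorEnergy_mono hQ.2 f]

theorem exists_isRegular_of_lt_factorEnergy (hδ : 0 < δ) (ω₁ : ℝ≥0 → ℝ) (hω₂ : ∀ t, 0 < ω₂ t)
    (m d₁ d₂ : ℕ) :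
    ∃ C : ℕ, ∀ (n : ℕ) (f : F5n n → ℝ) (Q₀ : QuadraticFactor n d₁ d₂), (∀ x, |f x| ≤ 1) →
      Q₀.RankAtLeast (ω₁ ((d₁ + d₂ : ℕ) : ℝ≥0)) → 1 - m * δ ^ 2 < factorEnergy Q₀.B₂ f →
      ∃ (e₁ e₂ : ℕ) (Q : QuadraticFactor n e₁ e₂), Q.Refines Q₀ ∧ e₁ ≤ C ∧ e₂ ≤ C ∧
        Q.IsRegular δ ω₁ ω₂ f := by
  induction m generalizing d₁ d₂ with
  | zero =>
    refine ⟨0, fun n f Q₀ hf _ energy_gt => absurd (factorEnergy_le_one Q₀.B₂ hf) (not_le.2 ?_)⟩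
    simpa using energy_gt
  | succ m ih =>
    choose C hC using ih
    obtain ⟨D, hD⟩ := exists_isRegular_or_energy_increment hδ ω₁ hω₂ d₁ d₂
    obtain ⟨C_max, le_C_max⟩ := exists_forall_le_of_le C D
    refine ⟨d₁ + d₂ + C_max, fun n f Q₀ hf hQ₀ energy_gt => ?_⟩
    obtain regular | ⟨a₁, a₂, Q', hQ', ha₁, ha₂, hQ'_rank, increment⟩ := hD n f Q₀ hf hQ₀
    · exact ⟨d₁, d₂, Q₀, .rfl, by omega, by omega, regular⟩
    · push_cast at energy_gt
      obtain ⟨e₁, e₂, Q, hQ, he₁, he₂, regular⟩ := hC a₁ a₂ n f Q' hf hQ'_rank (by linarith)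
      have C_le := le_C_max a₁ ha₁ a₂ ha₂
      exact ⟨e₁, e₂, Q, hQ.trans hQ', by omega, by omega, regular⟩

end Regularity

end

theorem mainTheorem3 (δ : ℝ) (hδ : 0 < δ) (ω₁ ω₂ : ℝ≥0 → ℝ)
    (hω₁ : ∀ t, 0 < ω₁ t) (hω₂ : ∀ t, 0 < ω₂ t) :
    ∃ (n₀ : ℕ) (C : ℕ → ℕ → ℕ), ∀ n : ℕ, n₀ < n →
      ∀ f : F5n n → ℝ, (∀ x, f x ∈ Set.Icc (-1 : ℝ) 1) →
      ∀ (e₁ e₂ : ℕ) (Q₀ : QuadraticFactor n e₁ e₂),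
      ∃ (d₁ d₂ : ℕ) (Q : QuadraticFactor n d₁ d₂),
        Q.Refines Q₀ ∧
        d₁ ≤ C e₁ e₂ ∧ d₂ ≤ C e₁ e₂ ∧
        Q.RankAtLeast (ω₁ ((d₁ + d₂ : ℕ) : ℝ≥0)) ∧
        ∃ f₁ f₂ f₃ : F5n n → ℝ,
          f = f₁ + f₂ + f₃ ∧
          f₁ = condAvg Q.B₂ f ∧
          l2Norm f₂ ≤ δ ∧
          gowersU3Norm f₃ ≤ 1 / ω₂ ((d₁ + d₂ : ℕ) : ℝ≥0) := by
  obtain ⟨m, hm⟩ := exists_nat_gt (1 / δ ^ 2)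
  choose C hC using exists_isRegular_of_lt_factorEnergy hδ ω₁ hω₂ m
  choose D hD using QuadraticFactor.exists_refines_rankAtLeast ω₁
  choose C_max le_C_max using fun e₁ e₂ => exists_forall_le_of_le C (D e₁ e₂)
  refine ⟨0, C_max, fun n _ f hf e₁ e₂ Q₀ => ?_⟩
  obtain ⟨a₁, a₂, Q', hQ', ha₁, ha₂, hQ'_rank⟩ := hD e₁ e₂ n Q₀
  have C_le := le_C_max e₁ e₂ a₁ ha₁ a₂ ha₂
  have energy_gt : 1 - m * δ ^ 2 < factorEnergy Q'.B₂ f := by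
    rw [div_lt_iff₀ (by positivity)] at hm
    linarith [factorEnergy_nonneg Q'.B₂ f]
  obtain ⟨d₁, d₂, Q, hQ, hd₁, hd₂, regular⟩ :=
    hC a₁ a₂ n f Q' (fun x => abs_le.2 (hf x)) hQ'_rank energy_gt
  exact ⟨d₁, d₂, Q, hQ.trans hQ', hd₁.trans C_le, hd₂.trans C_le, regular.rankAtLeast,
    regular.exists_decomposition⟩
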